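/- **Setting.** A public transit network consists of stops, finitely many lines and trips, and finitely many footpaths $\mathcal F$ between stops with traversal times $\ell(p,q)\in\mathbb N$; $\mathcal F$ contains $(p,p)$ with $\ell(p,p)=0$, is transitively closed and satisfies the triangle inequality. A trip $T$ has stop events $T[1],\dots,T[|T|]$, $|T|\ge 1$, with stops $p(T[i])$ and integer times $\tau_{arr}(T[i]),\tau_{dep}(T[i])$. Vehicles do not travel back in time: for some $b(p)\ge 0$ (a change time possibly subtracted from the departure times at $p$; $b=0$ if there is none), $\tau_{arr}(T[i])\le \tau_{dep}(T[i])+b(p(T[i]))\le\tau_{arr}(T[i+1])$ for $1\le i<|T|$. Trips of one line visit the same stop sequence and are totally ordered by $T\prec T'$ iff $\tau_{arr}(T[i])<\tau_{arr}(T'[i])$ and $\tau_{dep}(T[i])<\tau_{dep}(T'[i])$ for all $i$. A pair $(T_a[j],T_b[i])$ is a transfer if $(p(T_a[j]),p(T_b[i]))\in\mathcal F$ and $\tau_{arr}(T_a[j])+\ell(p(T_a[j]),p(T_b[i]))\le\tau_{dep}(T_b[i])$. **Journeys.** A journey is a sequence $J=\langle T_1[i_1,j_1],\dots,T_k[i_k,j_k]\rangle$,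 $k\ge1$, $1\le i_n<j_n\le|T_n|$, such that each $(T_n[j_n],T_{n+1}[i_{n+1}])$ is a transfer. A query $Q$ has a target stop $p_t$ and either a source stop $p_s$ with a departure time $\tau_{dep}$, or a source event $\varepsilon_s$. $J$ is feasible if $(p(T_k[j_k]),p_t)\in\mathcal F$ and, respectively, $(p_s,p(T_1[i_1]))\in\mathcal F$ with $\tau_{dep}(T_1[i_1])-\ell(p_s,p(T_1[i_1]))\ge\tau_{dep}$, or $T_1[i_1]=\varepsilon_s$. Its cost vector is $(\tau_{arr}(T_k[j_k])+\ell(p(T_k[j_k]),p_t),\,k)$. The Pareto front is the set of cost vectors of feasible journeys that are not dominated by the cost vector of any feasible journey. **Transfer precomputation.** Start from the transfers $(T_a[j],T_b[i])$ with $1<j\le|T_a|$, $1\le i<|T_b|$, except those with $T_a\preceq T_b$ and $j\le i$. Generation keeps, in the scheme of Lehoux and Loiodice, those $(T_a[k],T_c[l])$ for which no other such transfer $(T_a[i],T_b[j])$ has $k\le i$, $j\le l$, $T_b\preceq T_c$; in the scheme of Witt, those for which $T_b$ is the earliest trip of its line that can be entered at index $i$. Then transfers are removed one by one, in any order and not necessarily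 exhaustively, first by the U-turn rule ($(T_a[j],T_b[i])$ may be removed if $p(T_a[j-1])=p(T_b[i+1])$ and $(T_a[j-1],T_b[i+1])$ is in the current set), then by the latest-exit rule ($(T_a[j],T_b[i])$ may be removed if for every $l>i$ the current set contains some $(T_a[j'],T_c[i'])$ with $j'>j$ such that for some $l'>i'$, leaving $T_c$ at $T_c[l']$ and taking a footpath leads to $p(T_b[l])$ not later than $\tau_{arr}(T_b[l])$). Let $\mathfrak T$ be any resulting set, and let $\mathcal J(Q,\mathfrak T)$ be the set of feasible journeys all of whose transfers lie in $\mathfrak T$. **Order.** Fix injective integer IDs of footpaths, lines and transfers in $\mathfrak T$. The tiebreaking sequence of $J$ is $k$, followed by $\mathrm{ID}((p_s,p(T_1[i_1]))),\mathrm{ID}(L(T_1)),i_1,\tau_{dep}(T_1[1]),j_1$ for a stop-based query (where $L(T_1)$ is the line of $T_1$) and by $j_1$ for an event-based one, followed by $\mathrm{ID}((T_{n-1}[j_{n-1}],T_n[i_n])),j_n$ for $n=2,\dots,k$. $J\prec_QJ'$ means that the sequence of $J$ is lexicographically smaller. **Algorithm.** TB (Event-TB for event-based queries) works in rounds $n=1,2,\dots$,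 each scanning a FIFO queue of trip segments, with reached indices $R(T)$, initially $|T|+1$. To enqueue $T$ entered at index $b$ means: if $R(T)>b+1$, append the segment with events $T[b+1],\dots,T[R(T)-1]$ and a pointer to its parent segment, and go through the trips $T'\succeq T$ of the line in increasing order, setting $R(T')\leftarrow b+1$ until one with $R(T')\le b+1$ is met. The first queue results from relaxing the footpaths from $p_s$ and examining the lines at the reached stops, in ascending order of footpath ID, line ID and index, each time enqueueing the earliest reachable trip (event-based: from enqueueing the trip of $\varepsilon_s$ at its index). In round $n$, all queued events are scanned in order; whenever the final footpath to $p_t$ improves the earliest known arrival time $\tau_{\min}$ (initially $\infty$), $\tau_{\min}$ is updated and the cost vector $(\tau_{\min},n)$ is stored with its segment, removing dominated ones. Then, in order, all outgoing transfers in $\mathfrak T$ of the queued events are relaxed by ascending ID, enqueueing the entered trips for round $n+1$. If target pruning is enabled, a segment is cut off at its first event whose arrival time is at least $\tau_{\min}$, in both passes. When the queue is empty, the stored entries are returned, their journeys being reconstructed from the parent pointers, where the parent segment is left at the first event with a transfer in $\mathfrak T$ to the event at which the segment was entered. **Theorem (TB Correctness).** With or without target pruning, for every stop-based query and every event-based query,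 the algorithm terminates, and every journey it returns lies in $\mathcal J(Q,\mathfrak T)$ and has the cost vector for which it is returned. For every cost vector $(\tau_{arr},k)$ of the Pareto front, it returns exactly one representative, and this is the $\prec_Q$-minimal journey among all journeys in $\mathcal J(Q,\mathfrak T)$ with that cost vector. For the generation scheme of Lehoux and Loiodice this holds without exception. For the scheme of Witt, the last sentence is claimed in the stop-based case for those cost vectors with $\tau_{arr}<\tau_{dep}+\ell(p_s,p_t)$ if $(p_s,p_t)\in\mathcal F$ (all of them if $(p_s,p_t)\notin\mathcal F$), and in the event-based case for those that are attained by some journey in $\mathcal J(Q,\mathfrak T)$. -/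

import Mathlib

/-! Public transit networks, journeys, transfer precomputation and the query algorithm of
Trip-Based Public Transit Routing (TB), together with the tiebreaking order on journeys. -/

noncomputable section

namespace TB

/-- A stop event `T[i]`, given by the trip `T` and the index `i` (counted from `1`). -/
abbrev Event (Trip : Type*) := Trip × ℕ

/-- A pair of stop events `(T_a[j], T_b[i])`: exit `T_a` at `j`, then enter `T_b` at `i`. -/
abbrev Transfer (Trip : Type*) := Event Trip × Event Trip

/-- A public transit network. All trips of a line visit the same stop sequence and are totally
ordered. Values at indices outside `1, …, len` carry no meaning, and neither does `walk p q` if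
`(p, q)` is not a footpath. A nonnegative change time `buffer p` may have been subtracted from the
departure times at the stop `p` (take `buffer = 0` if there is none), so that `dep + buffer` is the
time at which the vehicle really leaves. -/
structure Network (Stop Line Trip : Type*) where
  /-- the footpaths -/
  footpaths : Finset (Stop × Stop)
  /-- the traversal times of the footpaths -/
  walk : Stop → Stop → ℕ
  /-- the line of a trip -/
  line : Trip → Line
  /-- the number of stop events of each trip of a line -/
  len : Line → ℕ
  /-- the stop sequence of a line -/
  stopAt : Line → ℕ → Stop
  /-- arrival times -/
  arr : Trip → ℕ → ℤ
  /-- departure times -/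
  dep : Trip → ℕ → ℤ
  /-- the change times that are contained in the departure times -/
  buffer : Stop → ℕ
  len_pos : ∀ L, 1 ≤ len L
  footpath_refl : ∀ p, (p, p) ∈ footpaths ∧ walk p p = 0
  footpath_trans : ∀ p q r, (p, q) ∈ footpaths → (q, r) ∈ footpaths →
    (p, r) ∈ footpaths ∧ walk p r ≤ walk p q + walk q r
  arr_le_leave : ∀ T i, 1 ≤ i → i < len (line T) →
    arr T i ≤ dep T i + buffer (stopAt (line T) i)
  leave_le_arr : ∀ T i, 1 ≤ i → i < len (line T) →
    dep T i + buffer (stopAt (line T) i) ≤ arr T (i + 1)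
  line_total : ∀ T T', line T = line T' → T ≠ T' →
    (∀ i, 1 ≤ i → i ≤ len (line T) → arr T i < arr T' i ∧ dep T i < dep T' i) ∨
    (∀ i, 1 ≤ i → i ≤ len (line T) → arr T' i < arr T i ∧ dep T' i < dep T i)

/-- The trip segment `T[board, exit]`. -/
structure Leg (Trip : Type*) where
  /-- the trip -/
  trip : Trip
  /-- the index at which the trip is entered -/
  board : ℕ
  /-- the index at which the trip is left -/
  exit : ℕ

/-- The start of a query: a stop with a departure time, or a stop event `T[i]`. -/
inductive Source (Stop Trip : Type*) where
  | fromStop (p : Stop) (τ : ℤ)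
  | fromEvent (T : Trip) (i : ℕ)

/-- A stop-based or event-based query with a target stop. -/
structure Query (Stop Trip : Type*) where
  /-- where the query starts -/
  source : Source Stop Trip
  /-- the target stop -/
  target : Stop

/-- The two schemes for generating the initial set of transfers. -/
inductive Scheme where
  | lehouxLoiodice
  | witt

/-- IDs for footpaths, lines and transfers, which fix the order in which they are explored. -/
structure IDs (Stop Line Trip : Type*) where
  /-- IDs of footpaths -/
  footpath : Stop × Stop → ℕ
  /-- IDs of lines -/
  line : Line → ℕ
  /-- IDs of transfers -/
  transfer : Transfer Trip → ℕ

/-- `c` is strictly smaller than `c'` in one criterion and not larger in the other. -/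
abbrev Dominates (c c' : ℤ × ℕ) : Prop :=
  c.1 ≤ c'.1 ∧ c.2 ≤ c'.2 ∧ (c.1 < c'.1 ∨ c.2 < c'.2)

/-- A trip segment in one of the queues of the search. It was entered at index `board`, its events
at the indices `board + 1, …, last` are scanned, and it points to its parent segment unless it
belongs to the first queue. -/
inductive Segment (Trip : Type*) where
  | first (T : Trip) (board last : ℕ)
  | next (parent : Segment Trip) (T : Trip) (board last : ℕ)

/-- The trip of a queued segment. -/
def Segment.trip {Trip : Type*} : Segment Trip → Trip
  | .first T _ _ => T
  | .next _ T _ _ => T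

/-- The indices `board + 1, …, last` of the events of a queued segment, in increasing order. -/
def Segment.indices {Trip : Type*} : Segment Trip → List ℕ
  | .first _ b l => List.range' (b + 1) (l - b)
  | .next _ _ b l => List.range' (b + 1) (l - b)

/-- The reached indices and the queue that is being filled. -/
structure Frontier (Trip : Type*) where
  /-- reached index of each trip -/
  reached : Trip → ℕ
  /-- the queue, in FIFO order -/
  queue : List (Segment Trip)

/-- An entry of the tentative Pareto front: the cost vector, and a pointer to the segment (with the
exit index) from which the final footpath was relaxed. -/
structure Entry (Trip : Type*) where
  /-- the cost vector: arrival time and number of trips -/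
  cost : ℤ × ℕ
  /-- the final trip segment -/
  seg : Segment Trip
  /-- the index at which it is left -/
  exit : ℕ

/-- The earliest known arrival time at the target and the tentative Pareto front. -/
structure Front (Trip : Type*) where
  /-- earliest known arrival time at the target, initially infinite -/
  tmin : WithTop ℤ
  /-- the tentative Pareto front -/
  entries : List (Entry Trip)

/-- The state of the search between two rounds. -/
structure State (Trip : Type*) where
  /-- reached indices and the queue of the next round -/
  frontier : Frontier Trip
  /-- earliest arrival time and tentative Pareto front -/
  front : Front Trip

variable {Stop Line Trip : Type*}

/-- The elements of a finite set in ascending order of a key. -/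
def sortBy {α β : Type*} [LinearOrder β] (key : α → β) (s : Finset α) : List α :=
  s.toList.insertionSort (fun a b => key a ≤ key b)

namespace Network

variable (N : Network Stop Line Trip)

/-- The stop visited by `T[i]`. -/
def evStop (e : Event Trip) : Stop := N.stopAt (N.line e.1) e.2

/-- The order `T ≺ T'` on the trips of a line. -/
def TripLT (T T' : Trip) : Prop :=
  N.line T = N.line T' ∧
    ∀ i, 1 ≤ i → i ≤ N.len (N.line T) → N.arr T i < N.arr T' i ∧ N.dep T i < N.dep T' i

/-- `T ⪯ T'`. -/
def TripLE (T T' : Trip) : Prop := N.TripLT T T' ∨ T = T'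

/-- The footpath exists, and the target event can be reached in time. -/
def IsTransfer (t : Transfer Trip) : Prop :=
  (N.evStop t.1, N.evStop t.2) ∈ N.footpaths ∧
    N.arr t.1.1 t.1.2 + N.walk (N.evStop t.1) (N.evStop t.2) ≤ N.dep t.2.1 t.2.2

/-! ### Transfer precomputation -/

/-- `(T_a[j], T_b[i])` is a transfer with `1 < j ≤ |T_a|` and `1 ≤ i < |T_b|`, and it is not a
transfer to the same or a later trip of the same line for which staying seated is preferable. -/
def Candidate (t : Transfer Trip) : Prop :=
  1 < t.1.2 ∧ t.1.2 ≤ N.len (N.line t.1.1) ∧ 1 ≤ t.2.2 ∧ t.2.2 < N.len (N.line t.2.1) ∧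
    N.IsTransfer t ∧ ¬ (N.TripLE t.1.1 t.2.1 ∧ t.1.2 ≤ t.2.2)

/-- The transfers of the initial generation step. In the scheme of Witt, the entered trip has to be
the earliest one of its line that can be entered at that index. In the scheme of Lehoux and
Loiodice, `(T_a[k], T_c[l])` is not generated if there is another `(T_a[i], T_b[j])` with `k ≤ i`,
`j ≤ l` and `T_b ⪯ T_c`. -/
def Generated : Scheme → Transfer Trip → Prop
  | .witt, t => N.Candidate t ∧ ∀ T, N.TripLT T t.2.1 → ¬ N.IsTransfer (t.1, (T, t.2.2))
  | .lehouxLoiodice, t => N.Candidate t ∧ ∀ u, N.Candidate u → u ≠ t → u.1.1 = t.1.1 →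
      ¬ (t.1.2 ≤ u.1.2 ∧ u.2.2 ≤ t.2.2 ∧ N.TripLE u.2.1 t.2.1)

/-- The U-turn rule prunes `(T_a[j], T_b[i])` if `T_a[j-1]` and `T_b[i+1]` are at the same stop and
`(T_a[j-1], T_b[i+1])` is in the transfer set. -/
def UTurn (A : Finset (Transfer Trip)) (t : Transfer Trip) : Prop :=
  N.evStop (t.1.1, t.1.2 - 1) = N.evStop (t.2.1, t.2.2 + 1) ∧
    ((t.1.1, t.1.2 - 1), (t.2.1, t.2.2 + 1)) ∈ A

/-- The latest-exit rule prunes `(T_a[j], T_b[i])` if every later event `T_b[l]` has an alternative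
that leaves `T_a` later than `j`, uses a transfer `(T_a[j'], T_c[i'])` of the transfer set, leaves
`T_c` at some `l'` and walks to the stop of `T_b[l]`, arriving there not later than `T_b[l]`. -/
def LatestExit (A : Finset (Transfer Trip)) (t : Transfer Trip) : Prop :=
  ∀ l, t.2.2 < l → l ≤ N.len (N.line t.2.1) →
    ∃ u ∈ A, u.1.1 = t.1.1 ∧ t.1.2 < u.1.2 ∧
      ∃ l', u.2.2 < l' ∧ l' ≤ N.len (N.line u.2.1) ∧
        (N.evStop (u.2.1, l'), N.evStop (t.2.1, l)) ∈ N.footpaths ∧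
        N.arr u.2.1 l' + N.walk (N.evStop (u.2.1, l')) (N.evStop (t.2.1, l)) ≤ N.arr t.2.1 l

/-- `B` results from `A` by removing one transfer to which the rule applies. -/
def PruneStep (rule : Finset (Transfer Trip) → Transfer Trip → Prop)
    (A B : Finset (Transfer Trip)) : Prop :=
  ∃ t ∈ A, rule A t ∧ (∀ u, u ∈ B ↔ u ∈ A ∧ u ≠ t)

/-- `𝔗` is a result of the transfer precomputation: generation, then the U-turn rule, then the
latest-exit rule. The rules may be applied to the transfers in any order, and exhaustively or not.
Pruning simultaneously all transfers to which a rule applies is a special case. -/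
def IsTransferSet (scheme : Scheme) (𝔗 : Finset (Transfer Trip)) : Prop :=
  ∃ G U : Finset (Transfer Trip), (∀ t, t ∈ G ↔ N.Generated scheme t) ∧
    Relation.ReflTransGen (PruneStep N.UTurn) G U ∧
    Relation.ReflTransGen (PruneStep N.LatestExit) U 𝔗

/-! ### Journeys and Pareto fronts -/

/-- A nonempty sequence of trip segments `T[board, exit]` with `1 ≤ board < exit ≤ |T|`, where
consecutive segments are connected by transfers. -/
def IsJourney (J : List (Leg Trip)) : Prop :=
  J ≠ [] ∧
  (∀ s ∈ J, 1 ≤ s.board ∧ s.board < s.exit ∧ s.exit ≤ N.len (N.line s.trip)) ∧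
  J.IsChain (fun a b => N.IsTransfer ((a.trip, a.exit), (b.trip, b.board)))

/-- The condition that a query imposes on the first segment: reachable from the source stop by a
footpath when leaving there not earlier than `τ`, or starting with the given event. -/
def StartsAt (s : Leg Trip) : Source Stop Trip → Prop
  | .fromStop p τ => (p, N.evStop (s.trip, s.board)) ∈ N.footpaths ∧
      τ ≤ N.dep s.trip s.board - N.walk p (N.evStop (s.trip, s.board))
  | .fromEvent T i => s.trip = T ∧ s.board = i

/-- The journeys that are feasible for `Q` and end (after a final footpath) at its target. -/
def Feasible (Q : Query Stop Trip) (J : List (Leg Trip)) : Prop :=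
  N.IsJourney J ∧ (∀ s ∈ J.head?, N.StartsAt s Q.source) ∧
    ∀ s ∈ J.getLast?, (N.evStop (s.trip, s.exit), Q.target) ∈ N.footpaths

/-- The cost vector (arrival time at the target stop, number of trips). -/
def cost (target : Stop) (J : List (Leg Trip)) : ℤ × ℕ :=
  match J.getLast? with
  | none => (0, 0)
  | some s => (N.arr s.trip s.exit + N.walk (N.evStop (s.trip, s.exit)) target, J.length)

/-- The Pareto front: the cost vectors of the feasible journeys that no feasible journey
dominates. -/
def paretoFront (Q : Query Stop Trip) : Set (ℤ × ℕ) :=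
  {c | (∃ J, N.Feasible Q J ∧ N.cost Q.target J = c) ∧
    ∀ J, N.Feasible Q J → ¬ Dominates (N.cost Q.target J) c}

/-- The feasible journeys for `Q` that use only transfers in `𝔗`. -/
def journeysIn (Q : Query Stop Trip) (𝔗 : Finset (Transfer Trip)) : Set (List (Leg Trip)) :=
  {J | N.Feasible Q J ∧ J.IsChain (fun a b => ((a.trip, a.exit), (b.trip, b.board)) ∈ 𝔗)}

/-! ### The tiebreaking order -/

/-- Different footpaths, lines and transfers of `𝔗` have different IDs. -/
def ValidIDs (ids : IDs Stop Line Trip) (𝔗 : Finset (Transfer Trip)) : Prop :=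
  Set.InjOn ids.footpath N.footpaths ∧ Function.Injective ids.line ∧ Set.InjOn ids.transfer 𝔗

/-- The entries for the segments that follow `a`: transfer ID and exit index of each. -/
def tiebreakTail (ids : IDs Stop Line Trip) (a : Leg Trip) : List (Leg Trip) → List ℤ
  | [] => []
  | b :: J => (ids.transfer ((a.trip, a.exit), (b.trip, b.board)) : ℤ) :: (b.exit : ℤ) ::
      tiebreakTail ids b J

/-- The entries for the first segment. -/
def tiebreakHead (ids : IDs Stop Line Trip) (s : Leg Trip) : Source Stop Trip → List ℤ
  | .fromStop p _ => [(ids.footpath (p, N.evStop (s.trip, s.board)) : ℤ), (ids.line (N.line s.trip) : ℤ),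
      (s.board : ℤ), N.dep s.trip 1, (s.exit : ℤ)]
  | .fromEvent _ _ => [(s.exit : ℤ)]

/-- The tiebreaking sequence of a journey. -/
def tiebreak (ids : IDs Stop Line Trip) (src : Source Stop Trip) : List (Leg Trip) → List ℤ
  | [] => []
  | s :: J => ((J.length + 1 : ℕ) : ℤ) :: (N.tiebreakHead ids s src ++ tiebreakTail ids s J)

/-- The order on journeys: lexicographic comparison of the tiebreaking sequences. -/
def Precedes (ids : IDs Stop Line Trip) (src : Source Stop Trip) (J J' : List (Leg Trip)) : Prop :=
  List.Lex (· < ·) (N.tiebreak ids src J) (N.tiebreak ids src J')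

/-- `J` is the minimal representative of the cost vector `c` among the feasible journeys that use
only transfers in `𝔗`. -/
def IsMinimalRep (ids : IDs Stop Line Trip) (𝔗 : Finset (Transfer Trip)) (Q : Query Stop Trip)
    (c : ℤ × ℕ) (J : List (Leg Trip)) : Prop :=
  J ∈ N.journeysIn Q 𝔗 ∧ N.cost Q.target J = c ∧
    ∀ J' ∈ N.journeysIn Q 𝔗, N.cost Q.target J' = c → J' ≠ J → N.Precedes ids Q.source J J'

/-! ### The query algorithm -/

section Search

variable [DecidableEq Stop] [DecidableEq Line] [Fintype Line] [DecidableEq Trip] [Fintype Trip]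

/-- The trips of a line, from the earliest to the latest. -/
def tripsOf (L : Line) : List Trip :=
  sortBy (fun T => N.dep T 1) (Finset.univ.filter (fun T => N.line T = L))

open Classical in
/-- The trips `T' ⪰ T`, from the earliest to the latest. -/
def tripsFrom (T : Trip) : List Trip :=
  (N.tripsOf (N.line T)).filter (fun T' => N.TripLE T T')

/-- Enqueue the trip `T`, entered at index `b`, unless `T[b+1]` has already been reached. The queued
segment ends before the reached index. Then the reached indices of `T` and the later trips of its
line are updated, up to the first one that needs no update. The queued segment is built by `mk`. -/
def enqueue (mk : Trip → ℕ → ℕ → Segment Trip) (F : Frontier Trip) (T : Trip) (b : ℕ) :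
    Frontier Trip :=
  if F.reached T ≤ b + 1 then F
  else
    { reached := fun T' =>
        if T' ∈ (N.tripsFrom T).takeWhile (fun T'' => b + 1 < F.reached T'') then b + 1
        else F.reached T'
      queue := F.queue ++ [mk T b (F.reached T - 1)] }

/-- No trip is reached yet. -/
def emptyFrontier : Frontier Trip :=
  { reached := fun T => N.len (N.line T) + 1, queue := [] }

/-- The first queue. For a stop, relax the outgoing footpaths and examine the lines at the reached
stops by ascending IDs and indices, each time entering the earliest reachable trip. For an event
`T[i]`, only this trip is entered, at index `i`. -/
def initialFrontier (ids : IDs Stop Line Trip) : Source Stop Trip → Frontier Trip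
  | .fromStop p τ =>
      (sortBy ids.footpath (N.footpaths.filter (fun f => f.1 = p))).foldl (fun F f =>
        (sortBy ids.line (Finset.univ : Finset Line)).foldl (fun F L =>
          ((List.range' 1 (N.len L)).filter (fun i => N.stopAt L i = f.2)).foldl (fun F i =>
            match (N.tripsOf L).find? (fun T => τ + N.walk p f.2 ≤ N.dep T i) with
            | none => F
            | some T => N.enqueue Segment.first F T i) F) F) N.emptyFrontier
  | .fromEvent T i => N.enqueue Segment.first N.emptyFrontier T i

/-- The first loop of a round for one segment `s`: while target pruning does not stop it, check for
each event whether the final footpath improves the earliest known arrival time; if so, insert the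
cost vector and remove the dominated ones. -/
def scanEvents (targetPruning : Bool) (target : Stop) (n : ℕ) (s : Segment Trip) :
    List ℕ → Front Trip → Front Trip
  | [], P => P
  | i :: is, P =>
      if targetPruning ∧ P.tmin ≤ (N.arr s.trip i : WithTop ℤ) then P
      else
        let p := N.evStop (s.trip, i)
        let a : ℤ := N.arr s.trip i + N.walk p target
        if (p, target) ∈ N.footpaths ∧ (a : WithTop ℤ) < P.tmin then
          scanEvents targetPruning target n s is
            { tmin := a
              entries := P.entries.filter (fun e => ¬ Dominates (a, n) e.cost) ++ [⟨(a, n), s, i⟩] }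
        else scanEvents targetPruning target n s is P

/-- The indices of a segment that remain after target pruning in the second loop of a round. -/
def keptIndices (targetPruning : Bool) (tmin : WithTop ℤ) (s : Segment Trip) : List ℕ :=
  if targetPruning then s.indices.takeWhile (fun i => (N.arr s.trip i : WithTop ℤ) < tmin)
  else s.indices

/-- Round `n`: look for new cost vectors, apply target pruning, relax the outgoing transfers. -/
def round (𝔗 : Finset (Transfer Trip)) (ids : IDs Stop Line Trip) (targetPruning : Bool)
    (target : Stop) (n : ℕ) (S : State Trip) : State Trip :=
  let P := S.frontier.queue.foldl
    (fun P s => N.scanEvents targetPruning target n s s.indices P) S.front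
  { front := P
    frontier := S.frontier.queue.foldl (fun F s =>
      (N.keptIndices targetPruning P.tmin s).foldl (fun F i =>
        (sortBy ids.transfer (𝔗.filter (fun t => t.1 = (s.trip, i)))).foldl (fun F t =>
          N.enqueue (Segment.next s) F t.2.1 t.2.2) F) F)
      { reached := S.frontier.reached, queue := [] } }

/-- The state of the search for `Q` after `n` rounds. With a source event this is Event-TB. Without
target pruning, the search itself does not depend on the target. -/
def search (𝔗 : Finset (Transfer Trip)) (ids : IDs Stop Line Trip) (targetPruning : Bool)
    (Q : Query Stop Trip) : ℕ → State Trip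
  | 0 => { frontier := N.initialFrontier ids Q.source, front := { tmin := ⊤, entries := [] } }
  | n + 1 => N.round 𝔗 ids targetPruning Q.target (n + 1) (search 𝔗 ids targetPruning Q n)

/-- The search ends with an empty queue. -/
def Terminates (𝔗 : Finset (Transfer Trip)) (ids : IDs Stop Line Trip) (targetPruning : Bool)
    (Q : Query Stop Trip) : Prop :=
  ∃ n, (N.search 𝔗 ids targetPruning Q n).frontier.queue = []

/-- The tentative Pareto front when the queue is empty for the first time. -/
def result (𝔗 : Finset (Transfer Trip)) (ids : IDs Stop Line Trip) (targetPruning : Bool)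
    (Q : Query Stop Trip) : List (Entry Trip) :=
  (N.search 𝔗 ids targetPruning Q
    (sInf {n | (N.search 𝔗 ids targetPruning Q n).frontier.queue = []})).front.entries

end Search

end Network

/-- Journey unpacking: follow the parent pointers. The index at which the parent segment is left is
the first one with a transfer that leads to the event at which the segment was entered. -/
def unpack [DecidableEq Trip] (𝔗 : Finset (Transfer Trip)) : Segment Trip → ℕ → List (Leg Trip)
  | .first T b _, j => [⟨T, b, j⟩]
  | .next s T b _, j =>
      unpack 𝔗 s ((s.indices.find? (fun e => ((s.trip, e), (T, b)) ∈ 𝔗)).getD 0) ++ [⟨T, b, j⟩]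

/-- The algorithm returns the journey `J` as the representative of the cost vector `c`. -/
def Network.Returns [DecidableEq Stop] [DecidableEq Line] [Fintype Line] [DecidableEq Trip]
    [Fintype Trip] (N : Network Stop Line Trip) (𝔗 : Finset (Transfer Trip))
    (ids : IDs Stop Line Trip) (targetPruning : Bool) (Q : Query Stop Trip)
    (c : ℤ × ℕ) (J : List (Leg Trip)) : Prop :=
  ∃ e ∈ N.result 𝔗 ids targetPruning Q, e.cost = c ∧ unpack 𝔗 e.seg e.exit = J

end TB

end

/-! The proof has three ingredients.

Repairing journeys. Suppose that `T` has been entered at `b` and a later trip is used to reach a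
stop by some time. By `IsTransferSet.onward`, the same is possible with a transfer in `𝔗` out of
`T`, or else a trip can be saved. Each excluded or pruned transfer is replaced by a better one or by
a shortcut. On a Pareto-optimal journey a shortcut is impossible, apart from the exceptions for
Witt's scheme. Hence `exists_replacement` repairs such a journey from front to back, and everything
up to the entry into `T` stays as it is. In particular the tiebreaking entries that are fixed on
entering `T` do not change.

The queue order is the tiebreaking order. The nested loops of a round enumerate the enqueue requests
in strictly ascending lexicographic order of their keys, where a key consists of the tiebreaking
entries known on entry (`segKey`). If a leg of the minimal representative were not queued up to its
exit index, another segment would have entered the same or an earlier trip of the line before that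
index. It belongs either to an earlier round, which would save a trip, or to the same round with a
smaller key. In the latter case, continuing from it with the rest of the journey and repairing the
result gives a journey in `𝔗` with the same cost and a smaller tiebreaking sequence. Both are
impossible (`not_preempted`), so the search follows the minimal representative leg by leg
(`exists_mem_queue`). Parent pointers reconstruct the correct exit indices, because among requests
with the same trip and entry index only the one with the smallest key can be queued.

The tentative front. Until the minimal representative of `c` is scanned, `tmin` stays above `c.1`:
an arrival by then would contradict Pareto-optimality in an earlier round and minimality in the same
round. So target pruning does not cut the journey off, its cost vector is stored (`mem_scanQueue`),
and no later entry dominates it. Stored arrival times decrease strictly, which makes the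
representative unique. The search ends because the sum of the reached indices decreases in every
round that fills the next queue. -/

namespace TB

section

variable {Stop Line Trip : Type*}

/-! ### Elementary facts on trips, and journeys as chains with an arrival bound -/

namespace Network

variable (N : Network Stop Line Trip)

/-- The index conditions on a trip segment of a journey. -/
def LegOK (s : Leg Trip) : Prop :=
  1 ≤ s.board ∧ s.board < s.exit ∧ s.exit ≤ N.len (N.line s.trip)

/-- From the stop `q` at time `τ`, the trip segments `J` lead to `target`, arriving at `A` or
earlier. -/
def Leads (target : Stop) (A : ℤ) : Stop → ℤ → List (Leg Trip) → Prop
  | q, τ, [] => (q, target) ∈ N.footpaths ∧ τ + N.walk q target ≤ A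
  | q, τ, s :: J => (q, N.evStop (s.trip, s.board)) ∈ N.footpaths ∧
      τ + N.walk q (N.evStop (s.trip, s.board)) ≤ N.dep s.trip s.board ∧ N.LegOK s ∧
      Leads target A (N.evStop (s.trip, s.exit)) (N.arr s.trip s.exit) J

/-- From the given source, the trip segments `J` lead to `target`, arriving at `A` or earlier. -/
def LeadsFrom (target : Stop) (A : ℤ) : Source Stop Trip → List (Leg Trip) → Prop
  | _, [] => False
  | .fromStop p τ, s :: J => N.Leads target A p τ (s :: J)
  | .fromEvent T i, s :: J => s.trip = T ∧ s.board = i ∧ N.LegOK s ∧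
      N.Leads target A (N.evStop (s.trip, s.exit)) (N.arr s.trip s.exit) J

variable {N}

lemma TripLT.trans {T₁ T₂ T₃ : Trip} (h : N.TripLT T₁ T₂) (h' : N.TripLT T₂ T₃) :
    N.TripLT T₁ T₃ := by
  refine ⟨h.1.trans h'.1, fun i hi hi' => ?_⟩
  have h1 := h.2 i hi hi'
  have h2 := h'.2 i hi (h.1 ▸ hi')
  exact ⟨h1.1.trans h2.1, h1.2.trans h2.2⟩

lemma TripLT.irrefl (T : Trip) : ¬ N.TripLT T T := fun h =>
  lt_irrefl _ (h.2 1 le_rfl (N.len_pos _)).1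

lemma TripLE.refl (T : Trip) : N.TripLE T T := Or.inr rfl

lemma TripLE.line_eq {T T' : Trip} (h : N.TripLE T T') : N.line T = N.line T' := by
  rcases h with h | rfl
  exacts [h.1, rfl]

lemma TripLE.arr_le {T T' : Trip} (h : N.TripLE T T') {i : ℕ} (hi : 1 ≤ i)
    (hi' : i ≤ N.len (N.line T)) : N.arr T i ≤ N.arr T' i := by
  rcases h with h | rfl
  exacts [(h.2 i hi hi').1.le, le_rfl]

lemma TripLE.evStop_eq {T T' : Trip} (h : N.TripLE T T') (i : ℕ) :
    N.evStop (T, i) = N.evStop (T', i) := by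
  simp [evStop, h.line_eq]

/-- On a line, the order of the trips is the order of their departures at any given index. -/
lemma tripLE_of_dep_le {T T' : Trip} (hl : N.line T = N.line T') {i : ℕ} (hi : 1 ≤ i)
    (hi' : i ≤ N.len (N.line T)) (h : N.dep T i ≤ N.dep T' i) : N.TripLE T T' := by
  by_cases hT : T = T'
  · exact Or.inr hT
  rcases N.line_total T T' hl hT with h' | h'
  · exact Or.inl ⟨hl, h'⟩
  · exact absurd (h' i hi hi').2 (not_lt.2 h)

lemma arr_mono {T : Trip} {i j : ℕ} (hi : 1 ≤ i) (hij : i ≤ j) (hj : j ≤ N.len (N.line T)) :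
    N.arr T i ≤ N.arr T j := by
  induction j, hij using Nat.le_induction with
  | base => exact le_rfl
  | succ j hij ih =>
    have h1 := ih (by omega)
    have h2 := N.arr_le_leave T j (by omega) (by omega)
    have h3 := N.leave_le_arr T j (by omega) (by omega)
    omega

lemma leave_le_arr_of_lt {T : Trip} {i j : ℕ} (hi : 1 ≤ i) (hij : i < j)
    (hj : j ≤ N.len (N.line T)) :
    N.dep T i + N.buffer (N.evStop (T, i)) ≤ N.arr T j :=
  (N.leave_le_arr T i hi (by omega)).trans (arr_mono (by omega) hij hj)

lemma dep_le_arr {T : Trip} {i j : ℕ} (hi : 1 ≤ i) (hij : i < j)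
    (hj : j ≤ N.len (N.line T)) : N.dep T i ≤ N.arr T j := by
  have := leave_le_arr_of_lt hi hij hj
  omega

section Leads

variable {target : Stop} {A A' : ℤ}

/-- Transitive closure and the triangle inequality absorb a footpath into the one that follows. A
replacement for a leg therefore only has to allow walking to the old exit stop in time. -/
lemma Leads.of_footpath {q q' : Stop} {τ τ' : ℤ} {J : List (Leg Trip)}
    (hq : (q', q) ∈ N.footpaths) (hτ : τ' + N.walk q' q ≤ τ) (h : N.Leads target A q τ J) :
    N.Leads target A q' τ' J := by
  cases J with
  | nil =>
    have := N.footpath_trans _ _ _ hq h.1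
    refine ⟨this.1, ?_⟩
    have := h.2
    omega
  | cons s J =>
    obtain ⟨h1, h2, h3⟩ := h
    have := N.footpath_trans _ _ _ hq h1
    exact ⟨this.1, by omega, h3⟩

lemma Leads.le {q : Stop} {τ : ℤ} {J : List (Leg Trip)} (h : N.Leads target A q τ J) : τ ≤ A := by
  induction J generalizing q τ with
  | nil => have := h.2; omega
  | cons s J ih =>
    have h1 := ih h.2.2.2
    have h2 := dep_le_arr h.2.2.1.1 h.2.2.1.2.1 h.2.2.1.2.2
    have := h.2.1
    omega

/-- The part before a leg depends only on where and when that leg is entered, so its exit and all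
that follows can be exchanged freely. -/
lemma Leads.swap {q : Stop} {τ : ℤ} {P J J' : List (Leg Trip)} {s s' : Leg Trip}
    (h : N.Leads target A q τ (P ++ s :: J)) (ht : s'.trip = s.trip) (hb : s'.board = s.board)
    (hs : N.LegOK s')
    (h' : N.Leads target A' (N.evStop (s'.trip, s'.exit)) (N.arr s'.trip s'.exit) J') :
    N.Leads target A' q τ (P ++ s' :: J') := by
  induction P generalizing q τ with
  | nil =>
    obtain ⟨h1, h2, -⟩ := h
    rw [← ht, ← hb] at h1 h2
    exact ⟨h1, h2, hs, h'⟩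
  | cons a P ih => exact ⟨h.1, h.2.1, h.2.2.1, ih h.2.2.2⟩

/-- Here `q'` and `τ'` are the place and time from which the walk to `s` starts. Any continuation
from there can be attached, which is how a leg is skipped altogether. -/
lemma Leads.drop {q : Stop} {τ : ℤ} {P J : List (Leg Trip)} {s : Leg Trip}
    (h : N.Leads target A q τ (P ++ s :: J)) :
    ∃ q' τ', (q', N.evStop (s.trip, s.board)) ∈ N.footpaths ∧
      τ' + N.walk q' (N.evStop (s.trip, s.board)) ≤ N.dep s.trip s.board ∧
      (P = [] → q' = q ∧ τ' = τ) ∧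
      ∀ J' A', N.Leads target A' q' τ' J' → N.Leads target A' q τ (P ++ J') := by
  induction P generalizing q τ with
  | nil => exact ⟨q, τ, h.1, h.2.1, fun _ => ⟨rfl, rfl⟩, fun _ _ h => h⟩
  | cons a P ih =>
    obtain ⟨q', τ', h1, h2, -, h3⟩ := ih h.2.2.2
    exact ⟨q', τ', h1, h2, by simp, fun J' A' hJ => ⟨h.1, h.2.1, h.2.2.1, h3 J' A' hJ⟩⟩

lemma Leads.rest {q : Stop} {τ : ℤ} {P J : List (Leg Trip)} {s : Leg Trip}
    (h : N.Leads target A q τ (P ++ s :: J)) : N.LegOK s ∧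
    N.Leads target A (N.evStop (s.trip, s.exit)) (N.arr s.trip s.exit) J := by
  induction P generalizing q τ with
  | nil => exact h.2.2
  | cons a P ih => exact ih h.2.2.2

lemma LeadsFrom.swap {src : Source Stop Trip} {P J J' : List (Leg Trip)} {s s' : Leg Trip}
    (h : N.LeadsFrom target A src (P ++ s :: J)) (ht : s'.trip = s.trip) (hb : s'.board = s.board)
    (hs : N.LegOK s')
    (h' : N.Leads target A' (N.evStop (s'.trip, s'.exit)) (N.arr s'.trip s'.exit) J') :
    N.LeadsFrom target A' src (P ++ s' :: J') := by
  cases src with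
  | fromStop p τ =>
    cases P with
    | nil => exact Leads.swap (P := []) h ht hb hs h'
    | cons a P => exact Leads.swap (P := a :: P) h ht hb hs h'
  | fromEvent T i =>
    cases P with
    | nil => exact ⟨ht.trans h.1, hb.trans h.2.1, hs, h'⟩
    | cons a P => exact ⟨h.1, h.2.1, h.2.2.1, h.2.2.2.swap ht hb hs h'⟩

/-- The first leg of an event-based query is prescribed and cannot be skipped, hence `hP`. The new
journey must be nonempty because walking alone is not a journey. -/
lemma LeadsFrom.drop {src : Source Stop Trip} {P J : List (Leg Trip)} {s : Leg Trip}
    (h : N.LeadsFrom target A src (P ++ s :: J)) (hP : ∀ T i, src = .fromEvent T i → P ≠ []) :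
    ∃ q' τ', (q', N.evStop (s.trip, s.board)) ∈ N.footpaths ∧
      τ' + N.walk q' (N.evStop (s.trip, s.board)) ≤ N.dep s.trip s.board ∧
      (P = [] → src = .fromStop q' τ') ∧
      ∀ J' A', P ++ J' ≠ [] → N.Leads target A' q' τ' J' → N.LeadsFrom target A' src (P ++ J') := by
  cases src with
  | fromStop p τ =>
    have h0 : N.Leads target A p τ (P ++ s :: J) := by cases P <;> exact h
    obtain ⟨q', τ', h1, h2, h3, h4⟩ := h0.drop
    refine ⟨q', τ', h1, h2, fun hP => ?_, fun J' A' hne hJ' => ?_⟩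
    · obtain ⟨rfl, rfl⟩ := h3 hP
      rfl
    · have := h4 J' A' hJ'
      revert hne this
      cases P ++ J' with
      | nil => exact fun h => absurd rfl h
      | cons a l => exact fun _ h => h
  | fromEvent T i =>
    cases P with
    | nil => exact absurd rfl (hP T i rfl)
    | cons a P =>
      obtain ⟨q', τ', h1, h2, -, h4⟩ := h.2.2.2.drop
      exact ⟨q', τ', h1, h2, by simp,
        fun J' A' _ hJ' => ⟨h.1, h.2.1, h.2.2.1, h4 J' A' hJ'⟩⟩

lemma LeadsFrom.rest {src : Source Stop Trip} {P J : List (Leg Trip)} {s : Leg Trip}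
    (h : N.LeadsFrom target A src (P ++ s :: J)) : N.LegOK s ∧
    N.Leads target A (N.evStop (s.trip, s.exit)) (N.arr s.trip s.exit) J := by
  cases src with
  | fromStop p τ =>
    cases P with
    | nil => exact Leads.rest (P := []) h
    | cons a P => exact Leads.rest (P := a :: P) h
  | fromEvent T i =>
    cases P with
    | nil => exact h.2.2
    | cons a P => exact h.2.2.2.rest

lemma leads_iff (s : Leg Trip) (J : List (Leg Trip)) :
    N.LegOK s ∧ N.Leads target A (N.evStop (s.trip, s.exit)) (N.arr s.trip s.exit) J ↔
      (N.IsJourney (s :: J) ∧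
        ∀ x ∈ (s :: J).getLast?, (N.evStop (x.trip, x.exit), target) ∈ N.footpaths) ∧
      (N.cost target (s :: J)).1 ≤ A := by
  induction J generalizing s with
  | nil => simp [Leads, IsJourney, cost, LegOK, and_assoc]
  | cons a J ih =>
    have hl : (s :: a :: J).getLast? = (a :: J).getLast? := by simp
    have hc : (N.cost target (s :: a :: J)).1 = (N.cost target (a :: J)).1 := by
      unfold cost
      rw [hl]
      cases (a :: J).getLast? <;> rfl
    rw [hl, hc]
    have := ih a
    simp only [IsJourney, List.isChain_cons_cons, List.forall_mem_cons, IsTransfer, Leads,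
      LegOK] at this ⊢
    constructor
    · rintro ⟨h1, h2, h3, h4⟩
      have := this.1 h4
      tauto
    · rintro ⟨⟨⟨h1, h2, h3⟩, h4⟩, h5⟩
      have := this.2 ⟨⟨⟨by simp, by tauto, h3.2⟩, h4⟩, h5⟩
      tauto

/-- Journeys that lead from the source of a query to its target are its feasible journeys. -/
lemma leadsFrom_iff {Q : Query Stop Trip} {J : List (Leg Trip)} :
    N.LeadsFrom Q.target A Q.source J ↔ N.Feasible Q J ∧ (N.cost Q.target J).1 ≤ A := by
  cases J with
  | nil => simp [LeadsFrom, Feasible, IsJourney]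
  | cons s J =>
    have h := leads_iff (N := N) (target := Q.target) (A := A) s J
    simp only [Feasible, List.head?_cons, Option.mem_def, Option.some.injEq, forall_eq',
      StartsAt] at h ⊢
    cases hs : Q.source with
    | fromStop p τ =>
      simp only [LeadsFrom, Leads, le_sub_iff_add_le]
      tauto
    | fromEvent T i =>
      simp only [LeadsFrom]
      tauto

end Leads

end Network

/-! ### Transfer precomputation preserves reachability -/

namespace Network

variable (N : Network Stop Line Trip)

/-- Being seated in `T` since the index `b`, one can leave it with a transfer in `R` and reach `q`
not later than `τ` with the entered trip. -/
def Onward (R : Transfer Trip → Prop) (T : Trip) (b : ℕ) (q : Stop) (τ : ℤ) : Prop :=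
  ∃ j x, b < j ∧ j ≤ N.len (N.line T) ∧ N.LegOK x ∧ R ((T, j), (x.trip, x.board)) ∧
    (N.evStop (x.trip, x.exit), q) ∈ N.footpaths ∧
    N.arr x.trip x.exit + N.walk (N.evStop (x.trip, x.exit)) q ≤ τ

/-- Instead of entering `T` at `b` and another trip later on, one can reach `q` not later than `τ`
with `T` alone or, if transfers were generated by the scheme of Witt, with the other trip alone or
with neither. -/
def Shortcut (scheme : Scheme) (T : Trip) (b : ℕ) (q : Stop) (τ : ℤ) : Prop :=
  (∃ j, b < j ∧ j ≤ N.len (N.line T) ∧ (N.evStop (T, j), q) ∈ N.footpaths ∧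
    N.arr T j + N.walk (N.evStop (T, j)) q ≤ τ) ∨
  scheme = .witt ∧
    ((∃ x, N.LegOK x ∧ N.evStop (x.trip, x.board) = N.evStop (T, b) ∧
      N.dep T b ≤ N.dep x.trip x.board ∧ (N.evStop (x.trip, x.exit), q) ∈ N.footpaths ∧
      N.arr x.trip x.exit + N.walk (N.evStop (x.trip, x.exit)) q ≤ τ) ∨
    ((N.evStop (T, b), q) ∈ N.footpaths ∧ N.dep T b + N.walk (N.evStop (T, b)) q ≤ τ))

variable {N} {T : Trip} {b : ℕ} {q : Stop} {τ : ℤ}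

lemma ncard_tripLT_lt [Finite Trip] {T T' : Trip} (h : N.TripLT T T') :
    {S | N.TripLT S T}.ncard < {S | N.TripLT S T'}.ncard := by
  apply Set.ncard_lt_ncard _ (Set.toFinite _)
  refine ⟨fun S hS => TripLT.trans hS h, fun hsub => ?_⟩
  exact TripLT.irrefl T (hsub h)

lemma Generated.candidate {scheme : Scheme} {t : Transfer Trip} (h : N.Generated scheme t) :
    N.Candidate t := by
  cases scheme <;> exact h.1

/-- A transfer that is not generated is inferior either to staying seated, which is a shortcut, or
to another transfer that exits later, enters earlier or enters an earlier trip. Repeating the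
improvement ends at a generated transfer. -/
lemma generated_onward [Finite Trip] (scheme : Scheme) (hb : 1 ≤ b)
    (h : N.Onward N.IsTransfer T b q τ) :
    N.Onward (N.Generated scheme) T b q τ ∨ N.Shortcut scheme T b q τ := by
  obtain ⟨j, x, hbj, hj, hx, ht, hq, hτ⟩ := h
  -- Each term is weakly decreased by a better transfer: the remaining length of `T` by a later
  -- exit, the entry index by an earlier entry, the number of preceding trips by an earlier trip.
  induction hm : N.len (N.line T) - j + x.board + {S | N.TripLT S x.trip}.ncard
    using Nat.strong_induction_on generalizing j x with
  | _ m ih =>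
  -- In this case `T` visits the same stops as `x.trip`, not later, and still reaches the index
  -- `x.exit` after `b`, so no transfer is needed.
  by_cases hc : N.TripLE T x.trip ∧ j ≤ x.board
  · refine .inr (.inl ⟨x.exit, by have := hx.2.1; omega, hc.1.line_eq ▸ hx.2.2, ?_⟩)
    have h1 := hc.1.arr_le (hx.1.trans hx.2.1.le) (hc.1.line_eq ▸ hx.2.2)
    rw [hc.1.evStop_eq]
    exact ⟨hq, by omega⟩
  have hcand : N.Candidate ((T, j), (x.trip, x.board)) :=
    ⟨by simp; omega, hj, hx.1, hx.2.1.trans_le hx.2.2, ht, hc⟩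
  by_cases hg : N.Generated scheme ((T, j), (x.trip, x.board))
  · exact .inl ⟨j, x, hbj, hj, hx, hg, hq, hτ⟩
  cases scheme with
  | witt =>
    simp only [Generated, hcand, true_and, not_forall, not_not] at hg
    obtain ⟨S, hS, hS'⟩ := hg
    have hle : N.TripLE S x.trip := .inl hS
    refine ih _ ?_ j ⟨S, x.board, x.exit⟩ hbj hj ⟨hx.1, hx.2.1, hle.line_eq ▸ hx.2.2⟩ hS' ?_ ?_ rfl
    · have := ncard_tripLT_lt hS
      simp only
      omega
    · rw [hle.evStop_eq]; exact hq
    · rw [hle.evStop_eq]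
      have := hle.arr_le (hx.1.trans hx.2.1.le) (hle.line_eq ▸ hx.2.2)
      simp only
      omega
  | lehouxLoiodice =>
    simp only [Generated, hcand, true_and, not_forall, not_not] at hg
    obtain ⟨⟨⟨T', j'⟩, ⟨S, i⟩⟩, hu, hne, hTT, hjj, hi, hle⟩ := hg
    dsimp only at hTT hjj hi hle
    subst hTT
    refine ih _ ?_ j' ⟨S, i, x.exit⟩ (by omega) hu.2.1
      ⟨hu.2.2.1, hi.trans_lt hx.2.1, hle.line_eq ▸ hx.2.2⟩ hu.2.2.2.2.1 ?_ ?_ rfl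
    · have h1 := hu.2.1
      dsimp only at h1 ⊢
      rcases hle with hlt | rfl
      · have := ncard_tripLT_lt hlt
        omega
      · have : ¬ (j' = j ∧ i = x.board) := by
          rintro ⟨rfl, rfl⟩
          exact hne rfl
        omega
    · rw [hle.evStop_eq]; exact hq
    · rw [hle.evStop_eq]
      have := hle.arr_le (hx.1.trans hx.2.1.le) (hle.line_eq ▸ hx.2.2)
      simp only
      omega

/-- In the scheme of Lehoux and Loiodice, the U-turn rule never applies. -/
lemma not_uTurn {A : Finset (Transfer Trip)}
    (hA : ∀ t ∈ A, N.Generated .lehouxLoiodice t) {t : Transfer Trip} (ht : t ∈ A) :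
    ¬ N.UTurn A t := by
  rintro ⟨-, h⟩
  have h1 := (hA t ht).1
  -- The transfer demanded by the rule exits one stop before `t` and enters the same trip one stop
  -- after it, so `t` itself would have prevented its generation.
  refine (hA _ h).2 t h1 ?_ rfl ⟨Nat.sub_le _ _, Nat.le_succ _, .refl _⟩
  intro h'
  have := congrArg (fun t => t.1.2) h'
  have := h1.1
  simp only at *
  omega

/-- The removed transfer rides one stop too far and comes back. Without this detour, one changes
from `T[j-1]` to index `x.board + 1` at the same stop. If `T` or `x.trip` is then ridden for no stop
at all, it disappears from the journey. -/
lemma uTurn_onward {scheme : Scheme} {A B : Finset (Transfer Trip)} (hb : 1 ≤ b)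
    (hA : ∀ t ∈ A, N.Generated scheme t) (hAB : PruneStep N.UTurn A B)
    (h : N.Onward (· ∈ A) T b q τ) :
    N.Onward (· ∈ B) T b q τ ∨ N.Shortcut scheme T b q τ := by
  obtain ⟨t, ht, hrule, hB⟩ := hAB
  cases scheme with
  | lehouxLoiodice => exact absurd hrule (not_uTurn hA ht)
  | witt =>
  obtain ⟨j, x, hbj, hj, hx, hxA, hq, hτ⟩ := h
  by_cases hxt : ((T, j), (x.trip, x.board)) = t
  · subst hxt
    obtain ⟨hturn, hmem⟩ := hrule
    simp only at hturn hmem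
    have htr := (hA _ ht).candidate.2.2.2.2.1.2
    simp only at htr
    obtain ⟨hx1, hx2, hx3⟩ := hx
    have hd1 : N.dep T (j - 1) + N.buffer (N.evStop (T, j - 1)) ≤ N.arr T j :=
      leave_le_arr_of_lt (by omega) (by omega) hj
    have hd2 := leave_le_arr_of_lt hx1 (lt_add_one x.board) (hx2.trans_le hx3)
    have hd3 := arr_mono (T := T) (i := j - 1) (by omega) (Nat.sub_le j 1) hj
    -- `j - 1 = b` means that `T` becomes superfluous, and `x.board + 1 = x.exit` that `x.trip`
    -- does.
    by_cases hj1 : j - 1 = b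
    · by_cases hi1 : x.board + 1 = x.exit
      · refine .inr (.inr ⟨rfl, .inr ?_⟩)
        rw [← hi1, ← hturn, hj1] at hq hτ
        rw [hj1] at hd1
        exact ⟨hq, by omega⟩
      · refine .inr (.inr ⟨rfl, .inl ⟨⟨x.trip, x.board + 1, x.exit⟩,
          ⟨by simp, by simp only; omega, hx3⟩, ?_, ?_, hq, hτ⟩⟩)
        · rw [← hj1, hturn]
        -- Both departures are at the same stop, so the same change time is contained in them and
        -- cancels.
        · have hd4 := N.arr_le_leave x.trip (x.board + 1) (by omega) (by omega)
          rw [hturn] at hd1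
          rw [← hj1]
          simp only [evStop] at hd1 ⊢
          omega
    · by_cases hi1 : x.board + 1 = x.exit
      · refine .inr (.inl ⟨j - 1, by omega, by omega, ?_⟩)
        rw [hturn]
        rw [← hi1] at hτ hq
        exact ⟨hq, by omega⟩
      · refine .inl ⟨j - 1, ⟨x.trip, x.board + 1, x.exit⟩, by omega, by omega,
          ⟨by simp, by simp only; omega, hx3⟩, (hB _).2 ⟨hmem, ?_⟩, hq, hτ⟩
        intro h'
        have := congrArg (fun t => t.1.2) h'
        simp only at this
        omega
  · exact .inl ⟨j, x, hbj, hj, hx, (hB _).2 ⟨hxA, hxt⟩, hq, hτ⟩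

/-- The alternative that the rule provides for `l = x.exit` leaves `T` strictly later than the
removed transfer. It is therefore a different transfer and survives the step. -/
lemma latestExit_onward {A B : Finset (Transfer Trip)} (hA : ∀ t ∈ A, N.Candidate t)
    (hAB : PruneStep N.LatestExit A B) (h : N.Onward (· ∈ A) T b q τ) :
    N.Onward (· ∈ B) T b q τ := by
  obtain ⟨t, ht, hrule, hB⟩ := hAB
  obtain ⟨j, x, hbj, hj, hx, hxA, hq, hτ⟩ := h
  by_cases hxt : ((T, j), (x.trip, x.board)) = t
  · subst hxt
    obtain ⟨⟨⟨T', j'⟩, ⟨S, i⟩⟩, hu, rfl, hjj, l, hl, hl', hf, hle⟩ := hrule x.exit hx.2.1 hx.2.2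
    have hc := hA _ hu
    have hft := N.footpath_trans _ _ _ hf hq
    refine ⟨j', ⟨S, i, l⟩, hbj.trans hjj, hc.2.1, ⟨hc.2.2.1, hl, hl'⟩, (hB _).2 ⟨hu, ?_⟩,
      hft.1, ?_⟩
    · intro h'
      have := congrArg (fun t => t.1.2) h'
      simp only at this hjj
      omega
    · have := hft.2
      simp only at *
      omega
  · exact ⟨j, x, hbj, hj, hx, (hB _).2 ⟨hxA, hxt⟩, hq, hτ⟩

lemma pruneSteps_subset {rule : Finset (Transfer Trip) → Transfer Trip → Prop}
    {A B : Finset (Transfer Trip)} (h : Relation.ReflTransGen (PruneStep rule) A B) : B ⊆ A := by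
  induction h with
  | refl => exact fun _ h => h
  | tail _ h ih =>
    obtain ⟨t, -, -, hB⟩ := h
    exact fun u hu => ih ((hB u).1 hu).1

lemma IsTransferSet.generated {scheme : Scheme} {𝔗 : Finset (Transfer Trip)}
    (h : N.IsTransferSet scheme 𝔗) {t : Transfer Trip} (ht : t ∈ 𝔗) : N.Generated scheme t := by
  obtain ⟨G, U, hG, hU, hT⟩ := h
  exact (hG t).1 (pruneSteps_subset hU (pruneSteps_subset hT ht))

/-- The transfer precomputation preserves reachability, up to journeys with fewer trips. -/
lemma IsTransferSet.onward [Finite Trip] {scheme : Scheme} {𝔗 : Finset (Transfer Trip)}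
    (h : N.IsTransferSet scheme 𝔗) (hb : 1 ≤ b) (h0 : N.Onward N.IsTransfer T b q τ) :
    N.Onward (· ∈ 𝔗) T b q τ ∨ N.Shortcut scheme T b q τ := by
  obtain ⟨G, U, hG, hU, hT⟩ := h
  have h1 : N.Onward (· ∈ G) T b q τ ∨ N.Shortcut scheme T b q τ := by
    simpa only [hG] using generated_onward scheme hb h0
  have h2 : N.Onward (· ∈ U) T b q τ ∨ N.Shortcut scheme T b q τ := by
    clear hT
    induction hU with
    | refl => exact h1
    | tail hs h ih =>
      exact ih.elim (fun h' => uTurn_onward hb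
        (fun t ht => (hG t).1 (pruneSteps_subset hs ht)) h h') .inr
  induction hT with
  | refl => exact h2
  | tail hs h ih =>
    exact ih.imp_left (latestExit_onward (fun t ht =>
      ((hG t).1 (pruneSteps_subset hU (pruneSteps_subset hs ht))).candidate) h)

/-- The conditions under which Pareto-optimal journeys can be replaced by journeys that use only
the precomputed transfers. -/
def Unexceptional (N : Network Stop Line Trip) (scheme : Scheme) (Q : Query Stop Trip) (c : ℤ × ℕ) :
    Prop :=
  scheme = .witt → ∀ p τ, Q.source = .fromStop p τ → (p, Q.target) ∈ N.footpaths →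
    c.1 < τ + N.walk p Q.target

/-! ### Repairing Pareto-optimal journeys -/

section Replace

variable {scheme : Scheme} {𝔗 : Finset (Transfer Trip)} {Q : Query Stop Trip} {c : ℤ × ℕ}

lemma cost_snd {target : Stop} {J : List (Leg Trip)} (hJ : J ≠ []) :
    (N.cost target J).2 = J.length := by
  unfold cost
  rw [List.getLast?_eq_getLast_of_ne_nil hJ]

/-- No feasible journey is better than a Pareto-optimal cost vector. -/
lemma pareto_length_le (hc : c ∈ N.paretoFront Q) {J : List (Leg Trip)} {A : ℤ}
    (hJ : N.LeadsFrom Q.target A Q.source J) (hA : A ≤ c.1) : c.2 ≤ J.length := by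
  by_contra hlt
  obtain ⟨h1, h2⟩ := leadsFrom_iff.1 hJ
  have := cost_snd (N := N) (target := Q.target) h1.1.1
  exact hc.2 J h1 ⟨h2.trans hA, by omega, .inr (by omega)⟩

lemma pareto_cost_eq (hc : c ∈ N.paretoFront Q) {J : List (Leg Trip)} {A : ℤ}
    (hJ : N.LeadsFrom Q.target A Q.source J) (hA : A ≤ c.1) (hl : J.length = c.2) :
    N.cost Q.target J = c := by
  obtain ⟨h1, h2⟩ := leadsFrom_iff.1 hJ
  have h3 := cost_snd (N := N) (target := Q.target) h1.1.1
  have h4 := hc.2 J h1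
  by_contra hne
  refine h4 ⟨h2.trans hA, by omega, .inl ?_⟩
  refine lt_of_le_of_ne (h2.trans hA) fun h => hne (Prod.ext h (by omega))

/-- The part of a Pareto-optimal journey after a prefix can be replaced by one that uses only the
precomputed transfers. -/
lemma exists_replacement [Finite Trip] (h𝔗 : N.IsTransferSet scheme 𝔗)
    (hc : c ∈ N.paretoFront Q) (hex : N.Unexceptional scheme Q c) {A : ℤ} (hA : A ≤ c.1)
    (J P : List (Leg Trip)) (T : Trip) (b j : ℕ)
    (h : N.LeadsFrom Q.target A Q.source (P ++ ⟨T, b, j⟩ :: J))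
    (hl : (P ++ ⟨T, b, j⟩ :: J).length = c.2)
    (hP : scheme = .witt → ∀ T i, Q.source = .fromEvent T i → P ≠ [])
    (hch : ∀ j, (P ++ [(⟨T, b, j⟩ : Leg Trip)]).IsChain
      (fun a b : Leg Trip => ((a.trip, a.exit), (b.trip, b.board)) ∈ 𝔗)) :
    ∃ j' J', P ++ ⟨T, b, j'⟩ :: J' ∈ N.journeysIn Q 𝔗 ∧
      N.cost Q.target (P ++ ⟨T, b, j'⟩ :: J') = c := by
  induction J generalizing P T b j with
  | nil => exact ⟨j, [], ⟨(leadsFrom_iff.1 h).1, hch j⟩, pareto_cost_eq hc h hA hl⟩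
  | cons x J ih =>
    obtain ⟨hok, hf, hd, hx, hJ⟩ := h.rest
    -- The stop and time to be met are those at which `x` is left, so the remaining legs `J` stay
    -- usable after a footpath.
    obtain h' | h' := h𝔗.onward hok.1 ⟨j, x, hok.2.1, hok.2.2, hx, ⟨hf, hd⟩,
      (N.footpath_refl _).1, (by simp [(N.footpath_refl _).2] : _ ≤ N.arr x.trip x.exit)⟩
    · obtain ⟨j', y, hbj', hj', hy, hm, hyf, hyd⟩ := h'
      have hty := (h𝔗.generated hm).candidate.2.2.2.2.1
      have h1 : N.LeadsFrom Q.target A Q.source (P ++ ⟨T, b, j'⟩ :: y :: J) :=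
        h.swap rfl rfl ⟨hok.1, hbj', hj'⟩ ⟨hty.1, hty.2, hy, hJ.of_footpath hyf hyd⟩
      obtain ⟨j'', J', h2, h3⟩ := ih (P ++ [⟨T, b, j'⟩]) y.trip y.board y.exit
        (by simpa using h1) (by simpa using hl) (by simp) (fun j'' => by
          rw [List.append_assoc]
          exact List.isChain_append_cons_cons.2 ⟨hch j', hm, List.isChain_singleton _⟩)
      exact ⟨j', ⟨y.trip, y.board, j''⟩ :: J', by simpa using h2, by simpa using h3⟩
    -- Every shortcut saves at least one trip without arriving later, against Pareto-optimality.
    · exfalso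
      rcases h' with ⟨j', hbj', hj', hyf, hyd⟩ | ⟨hw, h'⟩
      · have h1 : N.LeadsFrom Q.target A Q.source (P ++ ⟨T, b, j'⟩ :: J) :=
          h.swap rfl rfl ⟨hok.1, hbj', hj'⟩ (hJ.of_footpath hyf hyd)
        have := pareto_length_le hc h1 hA
        simp at this hl
        omega
      obtain ⟨q', τ', hq', hτ', hP', hdrop⟩ := h.drop (hP hw)
      rcases h' with ⟨y, hy, hyb, hdy, hyf, hyd⟩ | ⟨hyf, hyd⟩
      · have h1 := hdrop (y :: J) A (by simp) ⟨hyb ▸ hq', by rw [hyb]; exact hτ'.trans hdy, hy,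
          hJ.of_footpath hyf hyd⟩
        have := pareto_length_le hc h1 hA
        simp at this hl
        omega
      · have h0 := (hJ.of_footpath hyf hyd).of_footpath hq' hτ'
        -- If both skipped trips were the whole journey, only walking from source to target is left.
        -- This is not a journey and is excluded by `Unexceptional` instead.
        by_cases hne : P ++ J = []
        · obtain ⟨rfl, rfl⟩ := List.append_eq_nil_iff.1 hne
          have h1 := hex hw q' τ' (hP' rfl) h0.1
          have h2 := h0.2
          omega
        · have := pareto_length_le hc (hdrop J A hne h0) hA
          simp at this hl
          omega

end Replace

end Network

/-! ### Auxiliary facts on lists, queued segments and journey unpacking -/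

/-- Equal lengths rule out that `k` is a proper prefix of `k'`, so the comparison is decided before
the continuations begin. -/
lemma append_lt_append {α : Type*} [LinearOrder α] {k k' : List α} (h : k < k')
    (hl : k.length = k'.length) (l l' : List α) : k ++ l < k' ++ l' := by
  induction k generalizing k' with
  | nil =>
    cases k' with
    | nil => exact absurd h (lt_irrefl _)
    | cons => simp at hl
  | cons a k ih =>
    cases k' with
    | nil => simp at hl
    | cons a' k' =>
      simp only [List.cons_append, List.cons_lt_cons_iff] at h ⊢
      exact h.imp_right fun h => ⟨h.1, ih h.2 (by simpa using hl)⟩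

lemma mem_takeWhile {α : Type*} {r : α → α → Prop} {p : α → Bool} {l : List α}
    (hl : l.Pairwise r) {x : α} (hx : x ∈ l) (hpx : p x) (h : ∀ y ∈ l, r y x → p y) :
    x ∈ l.takeWhile p := by
  induction l with
  | nil => simp at hx
  | cons a l ih =>
    rw [List.pairwise_cons] at hl
    have ha : p a := by
      rcases List.mem_cons.1 hx with rfl | hx
      exacts [hpx, h a List.mem_cons_self (hl.1 x hx)]
    rw [List.takeWhile_cons_of_pos ha]
    rcases List.mem_cons.1 hx with rfl | hx
    · exact List.mem_cons_self
    · exact List.mem_cons_of_mem _ (ih hl.2 hx fun y hy => h y (List.mem_cons_of_mem _ hy))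

lemma mem_takeWhile_of_lt {p : ℕ → Bool} {l : List ℕ} (hl : l.Pairwise (· < ·)) {x y : ℕ}
    (hx : x ∈ l.takeWhile p) (hy : y ∈ l) (hyx : y < x) : y ∈ l.takeWhile p := by
  rw [← List.takeWhile_append_dropWhile (p := p) (l := l)] at hl hy
  rcases List.mem_append.1 hy with hy | hy
  · exact hy
  · exact absurd ((List.pairwise_append.1 hl).2.2 x hx y hy) (by omega)

/-- The index at which a segment was entered. -/
def Segment.board : Segment Trip → ℕ
  | .first _ b _ => b
  | .next _ _ b _ => b

/-- The index of the last event of a segment. -/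
def Segment.last : Segment Trip → ℕ
  | .first _ _ l => l
  | .next _ _ _ l => l

lemma Segment.indices_eq (s : Segment Trip) :
    s.indices = List.range' (s.board + 1) (s.last - s.board) := by
  cases s <;> rfl

lemma Segment.mem_indices {s : Segment Trip} {i : ℕ} :
    i ∈ s.indices ↔ s.board < i ∧ i ≤ s.last := by
  rw [s.indices_eq, List.mem_range'_1]
  omega

lemma Segment.pairwise_indices (s : Segment Trip) : s.indices.Pairwise (· < ·) := by
  rw [s.indices_eq]
  exact List.pairwise_lt_range' 1

section Unpack

variable [DecidableEq Trip] (𝔗 : Finset (Transfer Trip))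

/-- The index at which a segment is left in order to enter the next one. -/
def Segment.exitTo (s : Segment Trip) (e : Event Trip) : ℕ :=
  (s.indices.find? (fun i => ((s.trip, i), e) ∈ 𝔗)).getD 0

/-- The trip segments before the final one in the journeys that end with a segment. -/
def Segment.before : Segment Trip → List (Leg Trip)
  | .first _ _ _ => []
  | .next s T b _ => unpack 𝔗 s (s.exitTo 𝔗 (T, b))

variable {𝔗}

lemma unpack_eq (s : Segment Trip) (j : ℕ) :
    unpack 𝔗 s j = s.before 𝔗 ++ [⟨s.trip, s.board, j⟩] := by
  cases s <;> rfl

/-- The transfer at `i` makes the search for an exit succeed, so the default value `0` is never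
used. -/
lemma Segment.exitTo_spec {s : Segment Trip} {e : Event Trip} {i : ℕ} (hi : i ∈ s.indices)
    (ht : ((s.trip, i), e) ∈ 𝔗) :
    s.exitTo 𝔗 e ∈ s.indices ∧ ((s.trip, s.exitTo 𝔗 e), e) ∈ 𝔗 ∧ s.exitTo 𝔗 e ≤ i := by
  have hs : (s.indices.find? (fun i => ((s.trip, i), e) ∈ 𝔗)).isSome := by
    rw [List.find?_isSome]
    exact ⟨i, hi, by simpa using ht⟩
  obtain ⟨e', he'⟩ := Option.isSome_iff_exists.1 hs
  have heq : s.exitTo 𝔗 e = e' := by simp [exitTo, he']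
  rw [heq]
  obtain ⟨h1, as, bs, h2, h3⟩ := List.find?_eq_some_iff_append.1 he'
  refine ⟨List.mem_of_find?_eq_some he', by simpa using h1, ?_⟩
  have hp := s.pairwise_indices
  rw [h2] at hi hp
  rcases List.mem_append.1 hi with hi | hi
  · exact absurd ht (by simpa using h3 i hi)
  · rcases List.mem_cons.1 hi with rfl | hi
    · exact le_rfl
    · exact (List.pairwise_cons.1 (List.pairwise_append.1 hp).2.1).1 i hi |>.le

end Unpack

namespace Network

variable (N : Network Stop Line Trip)

lemma not_precedes_of_isMinimalRep {N : Network Stop Line Trip} {ids : IDs Stop Line Trip}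
    {𝔗 : Finset (Transfer Trip)} {Q : Query Stop Trip} {c : ℤ × ℕ} {J J' : List (Leg Trip)}
    (hmin : N.IsMinimalRep ids 𝔗 Q c J) (hJ' : J' ∈ N.journeysIn Q 𝔗)
    (hc : N.cost Q.target J' = c) : ¬ N.Precedes ids Q.source J' J := by
  intro h
  have h' : N.tiebreak ids Q.source J' < N.tiebreak ids Q.source J := h
  have hne : J' ≠ J := by
    rintro rfl
    exact lt_irrefl _ h'
  have h2 : N.tiebreak ids Q.source J < N.tiebreak ids Q.source J' := hmin.2.2 J' hJ' hc hne
  exact lt_asymm h' h2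

/-! ### Tiebreaking keys of segments -/

section Keys

variable [DecidableEq Trip]

/-- The entries of the tiebreaking sequence, except the number of trips, that are fixed when a
segment is entered. -/
def segKey (ids : IDs Stop Line Trip) (𝔗 : Finset (Transfer Trip)) (src : Source Stop Trip) :
    Segment Trip → List ℤ
  | .first T b _ => match src with
    | .fromStop p _ => [(ids.footpath (p, N.evStop (T, b)) : ℤ), (ids.line (N.line T) : ℤ),
        (b : ℤ), N.dep T 1]
    | .fromEvent _ _ => []
  | .next s T b _ => segKey ids 𝔗 src s ++
      [(s.exitTo 𝔗 (T, b) : ℤ), (ids.transfer ((s.trip, s.exitTo 𝔗 (T, b)), (T, b)) : ℤ)]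

variable {N} {ids : IDs Stop Line Trip} {𝔗 : Finset (Transfer Trip)} {src : Source Stop Trip}

/-- The key ends just before the exit index of the segment. Journeys of equal length are thus
compared first by the keys of their segments, provided that these have equal length, and only then
by what follows. -/
lemma tiebreak_unpack (s : Segment Trip) (j : ℕ) (J : List (Leg Trip)) :
    N.tiebreak ids src (unpack 𝔗 s j ++ J) = ((unpack 𝔗 s j ++ J).length : ℤ) ::
      (N.segKey ids 𝔗 src s ++ (j : ℤ) :: tiebreakTail ids ⟨s.trip, s.board, j⟩ J) := by
  induction s generalizing j J with
  | first T b l =>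
    cases src <;> simp [unpack, tiebreak, tiebreakHead, segKey, Segment.trip, Segment.board]
  | next s T b l ih =>
    have h : unpack 𝔗 (.next s T b l) j ++ J =
        unpack 𝔗 s (s.exitTo 𝔗 (T, b)) ++ (⟨T, b, j⟩ :: J) := by
      simp [unpack, Segment.exitTo]
    rw [h, ih]
    simp [segKey, tiebreakTail, Segment.trip, Segment.board]

/-- A segment of round `m` that leads to journeys for `Q` with transfers in `𝔗`. -/
structure Valid (N : Network Stop Line Trip) (𝔗 : Finset (Transfer Trip)) (Q : Query Stop Trip)
    (m : ℕ) (s : Segment Trip) : Prop where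
  board_pos : 1 ≤ s.board
  last_le : s.last ≤ N.len (N.line s.trip)
  leads : ∀ j J A, s.board < j → j ≤ N.len (N.line s.trip) →
    N.Leads Q.target A (N.evStop (s.trip, j)) (N.arr s.trip j) J →
    N.LeadsFrom Q.target A Q.source (unpack 𝔗 s j ++ J)
  chain : ∀ j, (unpack 𝔗 s j).IsChain
    (fun a b : Leg Trip => ((a.trip, a.exit), (b.trip, b.board)) ∈ 𝔗)
  length : ∀ j, (unpack 𝔗 s j).length = m

variable {Q : Query Stop Trip} {scheme : Scheme} {m : ℕ}

/-- Unpacking may choose an exit before `i`, but that exit also has a transfer in `𝔗` to the entered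
event. -/
lemma Valid.next {s : Segment Trip} (hs : N.Valid 𝔗 Q m s) (h𝔗 : N.IsTransferSet scheme 𝔗)
    {i : ℕ} {T : Trip} {b l : ℕ} (hi : i ∈ s.indices) (ht : ((s.trip, i), (T, b)) ∈ 𝔗)
    (hl : l ≤ N.len (N.line T)) : N.Valid 𝔗 Q (m + 1) (.next s T b l) := by
  obtain ⟨h1, h2, -⟩ := Segment.exitTo_spec hi ht
  have hc := (h𝔗.generated h2).candidate
  rw [Segment.mem_indices] at h1
  have he : ∀ j, unpack 𝔗 (.next s T b l) j = unpack 𝔗 s (s.exitTo 𝔗 (T, b)) ++ [⟨T, b, j⟩] :=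
    fun j => rfl
  refine ⟨hc.2.2.1, hl, fun j J A hj hj' hJ => ?_, fun j => ?_, fun j => ?_⟩
  · rw [he, List.append_assoc]
    exact hs.leads _ _ _ h1.1 (h1.2.trans hs.last_le)
      ⟨hc.2.2.2.2.1.1, hc.2.2.2.2.1.2, ⟨hc.2.2.1, hj, hj'⟩, hJ⟩
  · rw [he, unpack_eq, List.append_assoc]
    exact List.isChain_append_cons_cons.2
      ⟨unpack_eq (𝔗 := 𝔗) s _ ▸ hs.chain _, h2, List.isChain_singleton _⟩
  · rw [he, List.length_append, hs.length]
    rfl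

lemma Valid.of_source {p : Stop} {τ : ℤ} (hQ : Q.source = .fromStop p τ) {T : Trip} {b l : ℕ}
    (hb : 1 ≤ b) (hl : l ≤ N.len (N.line T)) (hf : (p, N.evStop (T, b)) ∈ N.footpaths)
    (hd : τ + N.walk p (N.evStop (T, b)) ≤ N.dep T b) : N.Valid 𝔗 Q 1 (.first T b l) := by
  refine ⟨hb, hl, fun j J A hj hj' hJ => ?_, fun j => List.isChain_singleton _, fun j => rfl⟩
  rw [hQ]
  exact ⟨hf, hd, ⟨hb, hj, hj'⟩, hJ⟩

lemma Valid.of_event {T : Trip} {b l : ℕ} (hQ : Q.source = .fromEvent T b)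
    (hb : 1 ≤ b) (hl : l ≤ N.len (N.line T)) : N.Valid 𝔗 Q 1 (.first T b l) := by
  refine ⟨hb, hl, fun j J A hj hj' hJ => ?_, fun j => List.isChain_singleton _, fun j => rfl⟩
  rw [hQ]
  exact ⟨rfl, rfl, ⟨hb, hj, hj'⟩, hJ⟩

/-- A minimal representative of a Pareto-optimal cost vector cannot be preempted by a segment that
enters an earlier or the same trip with fewer transfers or with a smaller tiebreaking sequence. -/
lemma not_preempted [Finite Trip] (h𝔗 : N.IsTransferSet scheme 𝔗) {c : ℤ × ℕ}
    (hc : c ∈ N.paretoFront Q) (hex : N.Unexceptional scheme Q c) {P J : List (Leg Trip)}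
    {x : Leg Trip} (hmin : N.IsMinimalRep ids 𝔗 Q c (P ++ x :: J)) {k l : List ℤ}
    (hk : N.tiebreak ids Q.source (P ++ x :: J) = ((P ++ x :: J).length : ℤ) :: (k ++ l))
    {s : Segment Trip} (hs : N.Valid 𝔗 Q m s) (hle : N.TripLE s.trip x.trip)
    (hb : s.board < x.exit)
    (hP : scheme = .witt → ∀ T i, Q.source = .fromEvent T i → P ≠ [])
    (h : m ≤ P.length ∨ m = P.length + 1 ∧ N.segKey ids 𝔗 Q.source s < k ∧
      (N.segKey ids 𝔗 Q.source s).length = k.length) : False := by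
  have h0 : N.LeadsFrom Q.target c.1 Q.source (P ++ x :: J) :=
    leadsFrom_iff.2 ⟨hmin.1.1, by rw [hmin.2.1]⟩
  have hl0 : (P ++ x :: J).length = c.2 := by
    rw [← cost_snd (N := N) (target := Q.target) (by simp), hmin.2.1]
  obtain ⟨hx, hJ⟩ := h0.rest
  have hxl : x.exit ≤ N.len (N.line s.trip) := hle.line_eq ▸ hx.2.2
  -- Change to the rival segment: its trip reaches the stop of `x.exit` not later than `x.trip`
  -- does, and the rest of the journey is kept.
  have h1 := hs.leads x.exit J c.1 hb hxl <| hJ.of_footpath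
    (by rw [hle.evStop_eq]; exact (N.footpath_refl _).1)
    (by rw [hle.evStop_eq, (N.footpath_refl _).2]
        simpa using hle.arr_le (hx.1.trans hx.2.1.le) hxl)
  have h2 := pareto_length_le hc h1 le_rfl
  rw [List.length_append, hs.length, ← hl0] at h2
  obtain ⟨hm, hlt, hkl⟩ : m = P.length + 1 ∧ N.segKey ids 𝔗 Q.source s < k ∧
      (N.segKey ids 𝔗 Q.source s).length = k.length := by
    refine h.resolve_left fun h => ?_
    simp at h2
    omega
  have hun : ∀ j J', s.before 𝔗 ++ ⟨s.trip, s.board, j⟩ :: J' = unpack 𝔗 s j ++ J' := by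
    simp [unpack_eq]
  have hP' : scheme = .witt → ∀ T i, Q.source = .fromEvent T i → s.before 𝔗 ≠ [] := by
    intro hw T i hT h0
    have := hs.length 0
    rw [unpack_eq, h0, hm] at this
    exact hP hw T i hT (by simpa using this)
  -- The transfer out of the rival trip need not lie in `𝔗`. The repair changes only what comes
  -- after entering that trip, hence not the key of `s`.
  obtain ⟨j', J', h3, h4⟩ := exists_replacement h𝔗 hc hex le_rfl J (s.before 𝔗) s.trip s.board
    x.exit (by rwa [hun]) (by
      rw [hun, List.length_append, hs.length, ← hl0, hm]
      simp
      omega) hP'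
    fun j => unpack_eq (𝔗 := 𝔗) s j ▸ hs.chain j
  rw [hun] at h3 h4
  refine not_precedes_of_isMinimalRep hmin h3 h4 ?_
  have hlen : (unpack 𝔗 s j' ++ J').length = (P ++ x :: J).length := by
    rw [hl0, ← cost_snd (N := N) (target := Q.target) h3.1.1.1, h4]
  have : N.tiebreak ids Q.source (unpack 𝔗 s j' ++ J') <
      N.tiebreak ids Q.source (P ++ x :: J) := by
    rw [hk, tiebreak_unpack, hlen, List.cons_lt_cons_iff]
    exact .inr ⟨rfl, append_lt_append hlt hkl _ _⟩
  exact this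

end Keys

/-! ### Sequences of enqueue operations -/

section Requests

lemma mem_sortBy {α β : Type*} [LinearOrder β] {key : α → β} {s : Finset α} {a : α} :
    a ∈ sortBy key s ↔ a ∈ s := by
  simp [sortBy]

lemma pairwise_sortBy {α β : Type*} [LinearOrder β] (key : α → β) (s : Finset α) :
    (sortBy key s).Pairwise (fun a b => key a ≤ key b) := by
  have : Std.Total (fun a b => key a ≤ key b) := ⟨fun a b => le_total _ _⟩
  have : IsTrans α (fun a b => key a ≤ key b) := ⟨fun a b c => le_trans⟩
  exact List.pairwise_insertionSort _ _

lemma pairwise_lt_sortBy {α β : Type*} [LinearOrder β] {key : α → β} {s : Finset α}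
    (h : Set.InjOn key s) : (sortBy key s).Pairwise (fun a b => key a < key b) := by
  have hnd : (sortBy key s).Nodup :=
    (List.perm_insertionSort _ _).nodup_iff.2 s.nodup_toList
  refine ((pairwise_sortBy key s).and hnd).imp_of_mem fun ha hb hab => ?_
  exact lt_of_le_of_ne hab.1 fun he =>
    hab.2 (h (by simpa using mem_sortBy.1 ha) (by simpa using mem_sortBy.1 hb) he)

lemma mem_tripsFrom [DecidableEq Line] [Fintype Trip] {N : Network Stop Line Trip} {T T' : Trip} : T' ∈ N.tripsFrom T ↔ N.TripLE T T' := by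
  simp only [tripsFrom, tripsOf, List.mem_filter, mem_sortBy, Finset.mem_filter, Finset.mem_univ,
    true_and, decide_eq_true_eq, and_iff_right_iff_imp]
  exact fun h => h.line_eq.symm

/-- `T` departs strictly before all later trips of its line, so nothing can stop the update loop
before it handles `T`. -/
lemma self_mem_takeWhile_tripsFrom [DecidableEq Line] [Fintype Trip]
    {N : Network Stop Line Trip} {T : Trip} {p : Trip → Bool} (hp : p T) :
    T ∈ (N.tripsFrom T).takeWhile p := by
  refine mem_takeWhile (r := fun S S' => N.dep S 1 ≤ N.dep S' 1)
    ((pairwise_sortBy _ _).sublist List.filter_sublist) (mem_tripsFrom.2 (.refl T)) hp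
    fun S hS hle => ?_
  rcases mem_tripsFrom.1 hS with h | rfl
  · exact absurd hle (not_le.2 (h.2 1 le_rfl (N.len_pos _)).2)
  · exact hp

/-- A request to enqueue a trip at an index, with the key that determines the order of requests. -/
structure Request (Trip : Type*) where
  /-- builds the queued segment -/
  build : Trip → ℕ → ℕ → Segment Trip
  /-- the entered trip -/
  trip : Trip
  /-- the index at which it is entered -/
  board : ℕ
  /-- the key -/
  key : List ℤ

/-- The segment that is queued for a request. -/
abbrev Request.seg (r : Request Trip) (l : ℕ) : Segment Trip := r.build r.trip r.board l

variable [DecidableEq Line] [DecidableEq Trip] [Fintype Trip]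

/-- Process a request. -/
noncomputable def serve (F : Frontier Trip) (r : Request Trip) : Frontier Trip :=
  N.enqueue r.build F r.trip r.board

variable {N}

lemma serve_of_le {F : Frontier Trip} {r : Request Trip} (h : F.reached r.trip ≤ r.board + 1) :
    N.serve F r = F := by
  simp [serve, enqueue, h]

lemma serve_queue {F : Frontier Trip} {r : Request Trip} (h : r.board + 1 < F.reached r.trip) :
    (N.serve F r).queue = F.queue ++ [r.seg (F.reached r.trip - 1)] := by
  simp [serve, enqueue, not_le.2 h]

lemma serve_reached_self (F : Frontier Trip) (r : Request Trip) :
    (N.serve F r).reached r.trip ≤ r.board + 1 := by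
  by_cases h : F.reached r.trip ≤ r.board + 1
  · rwa [serve_of_le h]
  · have := self_mem_takeWhile_tripsFrom (N := N) (T := r.trip)
      (p := fun T'' => r.board + 1 < F.reached T'') (by simpa using h)
    simp only [serve, enqueue, if_neg h]
    rw [if_pos this]

/-- Monotonicity of the reached indices along a line is not needed. It suffices that every decrease
is caused by entering the same or an earlier trip. -/
lemma serve_reached (F : Frontier Trip) (r : Request Trip) (T : Trip) :
    (N.serve F r).reached T = F.reached T ∨ r.board + 1 < F.reached r.trip ∧
      N.TripLE r.trip T ∧ (N.serve F r).reached T = r.board + 1 ∧ r.board + 1 < F.reached T := by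
  by_cases h : F.reached r.trip ≤ r.board + 1
  · exact .inl (by rw [serve_of_le h])
  · simp only [serve, enqueue, if_neg h]
    split_ifs with h'
    · refine .inr ⟨not_le.1 h, mem_tripsFrom.1 ((List.takeWhile_prefix _).subset h'), rfl, ?_⟩
      simpa using List.mem_takeWhile_imp h'
    · exact .inl rfl

lemma serve_reached_le (F : Frontier Trip) (r : Request Trip) (T : Trip) :
    (N.serve F r).reached T ≤ F.reached T := by
  rcases serve_reached (N := N) F r T with h | ⟨-, -, h, h'⟩ <;> omega

/-- What processing a list of requests does to the queue and the reached indices; `acc` lists the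
requests for which a segment is queued, with the last index of that segment. -/
structure Served (N : Network Stop Line Trip) (F F' : Frontier Trip) (l : List (Request Trip))
    (acc : List (Request Trip × ℕ)) : Prop where
  sublist : (acc.map Prod.fst).Sublist l
  queue_eq : F'.queue = F.queue ++ acc.map (fun x => x.1.seg x.2)
  lt_reached : ∀ x ∈ acc, x.1.board < x.2 ∧ x.2 < F.reached x.1.trip
  unique : ∀ x ∈ acc, ∀ r ∈ l, r.key < x.1.key → ¬ (r.trip = x.1.trip ∧ r.board = x.1.board)
  reached_eq : ∀ T, F'.reached T = F.reached T ∨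
    ∃ x ∈ acc, N.TripLE x.1.trip T ∧ x.1.board + 1 = F'.reached T
  reached_le : ∀ T, F'.reached T ≤ F.reached T
  reached_le_board : ∀ r ∈ l, F'.reached r.trip ≤ r.board + 1
  served : ∀ r ∈ l, ∀ j, r.board < j → (∃ i, j ≤ i ∧ (r, i) ∈ acc) ∨
    F.reached r.trip ≤ j ∨
    ∃ x ∈ acc, x.1.key < r.key ∧ N.TripLE x.1.trip r.trip ∧ x.1.board < j

omit [DecidableEq Line] [DecidableEq Trip] [Fintype Trip] in
lemma Served.seg_mem_queue {F F' : Frontier Trip} {l : List (Request Trip)}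
    {acc : List (Request Trip × ℕ)} (h : Served N F F' l acc) {r : Request Trip} {i : ℕ}
    (hr : (r, i) ∈ acc) : r.seg i ∈ F'.queue := by
  rw [h.queue_eq]
  exact List.mem_append_right _ (List.mem_map_of_mem (f := fun x => x.1.seg x.2) hr)

/-- Induction over the processed requests, appending the latest one, whose key is the largest.
Whatever blocks it was there before the batch or comes from a queued request with a smaller key. -/
lemma exists_served (F : Frontier Trip) (l : List (Request Trip))
    (hl : l.Pairwise (fun r r' => r.key < r'.key)) :
    ∃ acc, Served N F (l.foldl N.serve F) l acc := by
  induction l using List.reverseRecOn with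
  | nil => exact ⟨[], by constructor <;> simp⟩
  | append_singleton l r ih =>
    rw [List.pairwise_append] at hl
    obtain ⟨acc, h⟩ := ih hl.1
    have hlt : ∀ r' ∈ l, r'.key < r.key := fun r' hr' => hl.2.2 r' hr' r (by simp)
    rw [List.foldl_append, List.foldl_cons, List.foldl_nil]
    set F' := l.foldl N.serve F
    have hmem : ∀ x ∈ acc, x.1 ∈ l := fun x hx =>
      h.sublist.subset (List.mem_map_of_mem hx)
    have hunique : ∀ x ∈ acc, ∀ r' ∈ l ++ [r], r'.key < x.1.key →
        ¬ (r'.trip = x.1.trip ∧ r'.board = x.1.board) := by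
      intro x hx r' hr' hk
      rcases List.mem_append.1 hr' with hr' | hr'
      · exact h.unique x hx r' hr' hk
      · rw [List.mem_singleton.1 hr'] at hk
        exact absurd hk (hlt _ (hmem x hx)).not_gt
    have hboard : ∀ r' ∈ l ++ [r], (N.serve F' r).reached r'.trip ≤ r'.board + 1 := by
      intro r' hr'
      rcases List.mem_append.1 hr' with hr' | hr'
      · exact (serve_reached_le _ _ _).trans (h.reached_le_board r' hr')
      · rw [List.mem_singleton.1 hr']
        exact serve_reached_self _ _
    -- If the index `j` has been reached, then either before the batch or through a queued segment
    -- of the batch.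
    have hcase : ∀ j, F'.reached r.trip ≤ j → F.reached r.trip ≤ j ∨
        ∃ x ∈ acc, x.1.key < r.key ∧ N.TripLE x.1.trip r.trip ∧ x.1.board < j := by
      intro j hj
      rcases h.reached_eq r.trip with he | ⟨x, hx, hx1, hx2⟩
      · exact .inl (he ▸ hj)
      · exact .inr ⟨x, hx, hlt _ (hmem x hx), hx1, by omega⟩
    by_cases hr : F'.reached r.trip ≤ r.board + 1
    · rw [serve_of_le hr] at hboard ⊢
      refine ⟨acc, h.sublist.trans (List.sublist_append_left _ _), h.queue_eq, h.lt_reached,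
        hunique, h.reached_eq, h.reached_le, hboard, fun r' hr' j hj => ?_⟩
      rcases List.mem_append.1 hr' with hr' | hr'
      · exact h.served r' hr' j hj
      · rw [List.mem_singleton.1 hr'] at hj ⊢
        exact .inr (hcase j (by omega))
    · rw [not_le] at hr
      have hq := serve_queue (N := N) hr
      refine ⟨acc ++ [(r, F'.reached r.trip - 1)], ?_, ?_, ?_, ?_, ?_, ?_, hboard, ?_⟩
      · simpa using h.sublist.append (List.Sublist.refl [r])
      · rw [hq, h.queue_eq]
        simp
      · intro x hx
        rcases List.mem_append.1 hx with hx | hx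
        · exact h.lt_reached x hx
        · rw [List.mem_singleton.1 hx]
          have := h.reached_le r.trip
          simp only
          omega
      · intro x hx r' hr' hk
        rcases List.mem_append.1 hx with hx | hx
        · exact hunique x hx r' hr' hk
        · rw [List.mem_singleton.1 hx] at hk ⊢
          rcases List.mem_append.1 hr' with hr' | hr'
          · rintro ⟨h1, h2⟩
            -- An earlier request with the same trip and entry index would have lowered the reached
            -- index so far that `r` is not queued.
            have := h.reached_le_board r' hr'
            simp only at h1 h2
            rw [h1, h2] at this
            omega
          · rw [List.mem_singleton.1 hr'] at hk
            exact absurd hk (lt_irrefl _)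
      · intro T
        rcases serve_reached (N := N) F' r T with hT | ⟨-, hT, hT', -⟩
        · rw [hT]
          refine (h.reached_eq T).imp_right ?_
          rintro ⟨x, hx, hx'⟩
          exact ⟨x, List.mem_append_left _ hx, hx'⟩
        · exact .inr ⟨_, List.mem_append_right _ (List.mem_singleton_self _), hT, hT'.symm⟩
      · exact fun T => (serve_reached_le _ _ _).trans (h.reached_le T)
      · intro r' hr' j hj
        rcases List.mem_append.1 hr' with hr' | hr'
        · rcases h.served r' hr' j hj with ⟨i, hi, hi'⟩ | h' | ⟨x, hx, hx'⟩
          · exact .inl ⟨i, hi, List.mem_append_left _ hi'⟩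
          · exact .inr (.inl h')
          · exact .inr (.inr ⟨x, List.mem_append_left _ hx, hx'⟩)
        · rw [List.mem_singleton.1 hr'] at hj ⊢
          by_cases hj' : F'.reached r.trip ≤ j
          · rcases hcase j hj' with h' | ⟨x, hx, hx'⟩
            · exact .inr (.inl h')
            · exact .inr (.inr ⟨x, List.mem_append_left _ hx, hx'⟩)
          · exact .inl ⟨F'.reached r.trip - 1, by omega, by simp⟩

end Requests

end Network

namespace Network

/-! ### Invariants of the queue and of the reached indices -/

section Frontiers

variable [DecidableEq Trip]

lemma segKey_length {N : Network Stop Line Trip} {ids : IDs Stop Line Trip}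
    {𝔗 : Finset (Transfer Trip)} {src : Source Stop Trip} (s : Segment Trip) :
    (N.segKey ids 𝔗 src s).length =
      (match src with | .fromStop _ _ => 4 | .fromEvent _ _ => 0) + 2 * (s.before 𝔗).length := by
  induction s with
  | first T b l => cases src <;> rfl
  | next s T b l ih =>
    have : (Segment.next s T b l).before 𝔗 = unpack 𝔗 s (s.exitTo 𝔗 (T, b)) := rfl
    rw [this, unpack_eq, segKey, List.length_append, ih, List.length_append]
    simp only [List.length_cons, List.length_nil]
    omega

lemma Valid.segKey_length_eq {N : Network Stop Line Trip} (ids : IDs Stop Line Trip)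
    {𝔗 : Finset (Transfer Trip)} {Q : Query Stop Trip} {m : ℕ} {s s' : Segment Trip}
    (h : N.Valid 𝔗 Q m s) (h' : N.Valid 𝔗 Q m s') :
    (N.segKey ids 𝔗 Q.source s).length = (N.segKey ids 𝔗 Q.source s').length := by
  have h1 := (h.length 0).trans (h'.length 0).symm
  rw [unpack_eq, unpack_eq, List.length_append, List.length_append] at h1
  rw [segKey_length, segKey_length]
  simp only [List.length_cons, List.length_nil] at h1
  omega

/-- The state of the queue of round `m` and of the reached indices before that round. -/
structure FrontierInv (N : Network Stop Line Trip) (ids : IDs Stop Line Trip)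
    (𝔗 : Finset (Transfer Trip)) (Q : Query Stop Trip) (m : ℕ) (F : Frontier Trip) : Prop where
  valid : ∀ s ∈ F.queue, N.Valid 𝔗 Q m s
  sorted : F.queue.Pairwise (fun s s' => N.segKey ids 𝔗 Q.source s < N.segKey ids 𝔗 Q.source s')
  reached_le : ∀ T, F.reached T ≤ N.len (N.line T) + 1
  reached_eq : ∀ T, F.reached T = N.len (N.line T) + 1 ∨
    ∃ m' ≤ m, ∃ s, N.Valid 𝔗 Q m' s ∧ N.TripLE s.trip T ∧ s.board + 1 = F.reached T

/-- The segments queued for requests are valid, and their keys are those of the requests. -/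
def Sound (N : Network Stop Line Trip) (ids : IDs Stop Line Trip)
    (𝔗 : Finset (Transfer Trip)) (Q : Query Stop Trip) (m : ℕ) (acc : List (Request Trip × ℕ)) :
    Prop :=
  ∀ x ∈ acc, N.Valid 𝔗 Q m (x.1.seg x.2) ∧ N.segKey ids 𝔗 Q.source (x.1.seg x.2) = x.1.key ∧
    (x.1.seg x.2).trip = x.1.trip ∧ (x.1.seg x.2).board = x.1.board

variable [DecidableEq Line] [Fintype Trip]

variable {N : Network Stop Line Trip} {ids : IDs Stop Line Trip} {𝔗 : Finset (Transfer Trip)}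
  {Q : Query Stop Trip} {scheme : Scheme} {m : ℕ}

omit [DecidableEq Line] [Fintype Trip] in
lemma Served.frontierInv {F F' : Frontier Trip} {l : List (Request Trip)}
    {acc : List (Request Trip × ℕ)} (h : Served N F F' l acc) (hF : F.queue = [])
    (hl : l.Pairwise (fun r r' => r.key < r'.key)) (hacc : N.Sound ids 𝔗 Q m acc)
    (hle : ∀ T, F.reached T ≤ N.len (N.line T) + 1)
    (heq : ∀ T, F.reached T = N.len (N.line T) + 1 ∨
      ∃ m' ≤ m, ∃ s, N.Valid 𝔗 Q m' s ∧ N.TripLE s.trip T ∧ s.board + 1 = F.reached T) :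
    N.FrontierInv ids 𝔗 Q m F' := by
  have hq : F'.queue = acc.map (fun x => x.1.seg x.2) := by rw [h.queue_eq, hF, List.nil_append]
  refine ⟨?_, ?_, fun T => (h.reached_le T).trans (hle T), fun T => ?_⟩
  · rw [hq]
    simp only [List.mem_map, forall_exists_index, and_imp, forall_apply_eq_imp_iff₂]
    exact fun x hx => (hacc x hx).1
  · rw [hq, List.pairwise_map]
    have := List.pairwise_map.1 (hl.sublist h.sublist)
    refine this.imp_of_mem fun ha hb hab => ?_
    rwa [(hacc _ ha).2.1, (hacc _ hb).2.1]
  · rcases h.reached_eq T with h' | ⟨x, hx, hx1, hx2⟩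
    · rw [h']
      exact heq T
    · obtain ⟨h1, -, h2, h3⟩ := hacc x hx
      exact .inr ⟨m, le_rfl, _, h1, h2 ▸ hx1, by rw [h3, hx2]⟩

omit [DecidableEq Line] in
/-- The request that corresponds to a trip segment of a minimal representative is served. -/
lemma Served.exists_mem_acc (h𝔗 : N.IsTransferSet scheme 𝔗) {c : ℤ × ℕ}
    (hc : c ∈ N.paretoFront Q) (hex : N.Unexceptional scheme Q c) {P J : List (Leg Trip)}
    {x : Leg Trip} (hmin : N.IsMinimalRep ids 𝔗 Q c (P ++ x :: J))
    (hP : scheme = .witt → ∀ T i, Q.source = .fromEvent T i → P ≠ [])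
    {F F' : Frontier Trip} {l : List (Request Trip)}
    {acc : List (Request Trip × ℕ)} (h : Served N F F' l acc)
    (hacc : N.Sound ids 𝔗 Q (P.length + 1) acc)
    (heq : ∀ T, F.reached T = N.len (N.line T) + 1 ∨
      ∃ m' ≤ P.length, ∃ s, N.Valid 𝔗 Q m' s ∧ N.TripLE s.trip T ∧ s.board + 1 = F.reached T)
    {r : Request Trip} (hr : r ∈ l) (ht : r.trip = x.trip) (hb : r.board = x.board) {k : List ℤ}
    (hk : N.tiebreak ids Q.source (P ++ x :: J) = ((P ++ x :: J).length : ℤ) :: (r.key ++ k))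
    (hkl : ∀ y ∈ acc, y.1.key.length = r.key.length) :
    ∃ i, x.exit ≤ i ∧ (r, i) ∈ acc := by
  have h0 : N.LeadsFrom Q.target c.1 Q.source (P ++ x :: J) :=
    leadsFrom_iff.2 ⟨hmin.1.1, by rw [hmin.2.1]⟩
  have hx := h0.rest.1
  rcases h.served r hr x.exit (by rw [hb]; exact hx.2.1) with h' | h' | ⟨y, hy, hy1, hy2, hy3⟩
  · exact h'
  · exfalso
    rw [ht] at h'
    rcases heq x.trip with h'' | ⟨m', hm', s, hs, hs1, hs2⟩
    · have := hx.2.2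
      omega
    · exact not_preempted h𝔗 hc hex hmin hk hs hs1 (by omega) hP (.inl hm')
  · exfalso
    obtain ⟨h1, h2, h3, h4⟩ := hacc y hy
    exact not_preempted h𝔗 hc hex hmin hk h1 (by rw [h3, ← ht]; exact hy2) (by rw [h4]; exact hy3)
      hP (.inr ⟨rfl, by rw [h2]; exact hy1, by rw [h2]; exact hkl y hy⟩)

/-- The requests of a round in which the events of each segment `s` at the indices `K s` are
considered. -/
noncomputable def roundRequests (N : Network Stop Line Trip) (𝔗 : Finset (Transfer Trip))
    (ids : IDs Stop Line Trip) (src : Source Stop Trip) (K : Segment Trip → List ℕ)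
    (queue : List (Segment Trip)) : List (Request Trip) :=
  queue.flatMap fun s => (K s).flatMap fun i =>
    (sortBy ids.transfer (𝔗.filter (fun t => t.1 = (s.trip, i)))).map fun t =>
      ⟨Segment.next s, t.2.1, t.2.2, N.segKey ids 𝔗 src s ++ [(i : ℤ), (ids.transfer t : ℤ)]⟩

omit [DecidableEq Line] [Fintype Trip] in
lemma mem_roundRequests {src : Source Stop Trip} {K : Segment Trip → List ℕ}
    {queue : List (Segment Trip)} {r : Request Trip} :
    r ∈ N.roundRequests 𝔗 ids src K queue ↔ ∃ s ∈ queue, ∃ i ∈ K s, ∃ T b,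
      ((s.trip, i), (T, b)) ∈ 𝔗 ∧ r = ⟨Segment.next s, T, b, N.segKey ids 𝔗 src s ++
        [(i : ℤ), (ids.transfer ((s.trip, i), (T, b)) : ℤ)]⟩ := by
  simp only [roundRequests, List.mem_flatMap, List.mem_map, mem_sortBy, Finset.mem_filter]
  constructor
  · rintro ⟨s, hs, i, hi, ⟨e, T, b⟩, ⟨ht, rfl⟩, rfl⟩
    exact ⟨s, hs, i, hi, T, b, ht, rfl⟩
  · rintro ⟨s, hs, i, hi, T, b, ht, rfl⟩
    exact ⟨s, hs, i, hi, _, ⟨ht, rfl⟩, rfl⟩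

lemma append_lt_append_left {k l l' : List ℤ} (h : l < l') : k ++ l < k ++ l' := by
  induction k with
  | nil => exact h
  | cons a k ih => exact List.cons_lt_cons_iff.2 (.inr ⟨rfl, ih⟩)

omit [DecidableEq Line] [Fintype Trip] in
-- The loops over the sorted queue, the ascending indices and the ascending transfer IDs match the
-- lexicographic order of the extended keys. Keys of the same round have equal length, so the
-- extensions do not disturb the order of the queue.
lemma pairwise_roundRequests (hids : Set.InjOn ids.transfer 𝔗) {K : Segment Trip → List ℕ}
    (hK : ∀ s, (K s).Pairwise (· < ·)) {F : Frontier Trip} (hF : N.FrontierInv ids 𝔗 Q m F) :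
    (N.roundRequests 𝔗 ids Q.source K F.queue).Pairwise (fun r r' => r.key < r'.key) := by
  rw [roundRequests, List.pairwise_flatMap]
  refine ⟨fun s hs => ?_, hF.sorted.imp_of_mem fun {s s'} hs hs' hss => ?_⟩
  · rw [List.pairwise_flatMap]
    refine ⟨fun i hi => ?_, (hK s).imp fun {i i'} hii => ?_⟩
    · rw [List.pairwise_map]
      refine (pairwise_lt_sortBy (hids.mono ?_)).imp fun {t t'} h => ?_
      · intro t ht
        exact (Finset.mem_filter.1 ht).1
      · exact append_lt_append_left (by simpa [List.cons_lt_cons_iff] using h)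
    · simp only [List.mem_map, forall_exists_index, and_imp, forall_apply_eq_imp_iff₂]
      exact fun t _ t' _ => append_lt_append_left (by simp [List.cons_lt_cons_iff, hii])
  · simp only [List.mem_flatMap, List.mem_map, forall_exists_index, and_imp]
    rintro _ i - t - rfl _ i' - t' - rfl
    exact append_lt_append hss ((hF.valid s hs).segKey_length_eq ids (hF.valid s' hs')) _ _

omit [DecidableEq Line] [Fintype Trip] in
lemma sound_roundRequests (h𝔗 : N.IsTransferSet scheme 𝔗) {K : Segment Trip → List ℕ}
    (hK : ∀ s, (K s) ⊆ s.indices)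
    (hK' : ∀ s, ∀ i ∈ K s, ∀ e ∈ s.indices, e < i → e ∈ K s)
    {F F₀ F' : Frontier Trip} (hF : N.FrontierInv ids 𝔗 Q m F) (hF₀ : F₀.reached = F.reached)
    {acc : List (Request Trip × ℕ)}
    (h : Served N F₀ F' (N.roundRequests 𝔗 ids Q.source K F.queue) acc) :
    N.Sound ids 𝔗 Q (m + 1) acc := by
  rintro ⟨r, last⟩ hx
  have hr : r ∈ N.roundRequests 𝔗 ids Q.source K F.queue :=
    h.sublist.subset (List.mem_map_of_mem hx)
  obtain ⟨s, hs, i, hi, T, b, ht, rfl⟩ := mem_roundRequests.1 hr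
  have hlast := (h.lt_reached _ hx).2
  rw [hF₀] at hlast
  have hlen := hF.reached_le T
  refine ⟨(hF.valid s hs).next h𝔗 (hK s hi) ht (by dsimp only at hlast ⊢; omega), ?_, rfl, rfl⟩
  obtain ⟨h1, h2, h3⟩ := Segment.exitTo_spec (hK s hi) ht
  -- If unpacking chose an earlier exit, that exit would also be kept by `hK'`. It would have issued
  -- a request with a smaller key for the same event, and the present one would not have been
  -- queued.
  have he : s.exitTo 𝔗 (T, b) = i := by
    by_contra hne
    have hlt : s.exitTo 𝔗 (T, b) < i := lt_of_le_of_ne h3 hne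
    refine h.unique _ hx _ (mem_roundRequests.2
      ⟨s, hs, _, hK' s i hi _ h1 hlt, T, b, h2, rfl⟩) ?_ ⟨rfl, rfl⟩
    exact append_lt_append_left (by simp [List.cons_lt_cons_iff, hlt])
  simp [segKey, he]

lemma exists_served_round (h𝔗 : N.IsTransferSet scheme 𝔗) (hids : Set.InjOn ids.transfer 𝔗)
    {K : Segment Trip → List ℕ} (hK : ∀ s, (K s) ⊆ s.indices) (hKs : ∀ s, (K s).Pairwise (· < ·))
    (hK' : ∀ s, ∀ i ∈ K s, ∀ e ∈ s.indices, e < i → e ∈ K s) {F : Frontier Trip}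
    (hF : N.FrontierInv ids 𝔗 Q m F) :
    ∃ acc, Served N ⟨F.reached, []⟩
      ((N.roundRequests 𝔗 ids Q.source K F.queue).foldl N.serve ⟨F.reached, []⟩)
      (N.roundRequests 𝔗 ids Q.source K F.queue) acc ∧ N.Sound ids 𝔗 Q (m + 1) acc ∧
      N.FrontierInv ids 𝔗 Q (m + 1)
        ((N.roundRequests 𝔗 ids Q.source K F.queue).foldl N.serve ⟨F.reached, []⟩) := by
  have hp := pairwise_roundRequests (m := m) hids hKs hF
  obtain ⟨acc, h⟩ := exists_served (N := N) ⟨F.reached, []⟩ _ hp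
  have hs := sound_roundRequests (F₀ := ⟨F.reached, []⟩) h𝔗 hK hK' hF rfl h
  refine ⟨acc, h, hs, h.frontierInv rfl hp hs hF.reached_le fun T => ?_⟩
  refine (hF.reached_eq T).imp_right ?_
  rintro ⟨m', hm', h'⟩
  exact ⟨m', by omega, h'⟩

end Frontiers

/-! ### The first queue -/

section Initial

variable [DecidableEq Stop] [DecidableEq Line] [Fintype Line] [DecidableEq Trip] [Fintype Trip]

/-- The requests from which the first queue results. -/
noncomputable def initialRequests (N : Network Stop Line Trip) (ids : IDs Stop Line Trip) :
    Source Stop Trip → List (Request Trip)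
  | .fromStop p τ =>
      (sortBy ids.footpath (N.footpaths.filter (fun f => f.1 = p))).flatMap fun f =>
        (sortBy ids.line (Finset.univ : Finset Line)).flatMap fun L =>
          ((List.range' 1 (N.len L)).filter (fun i => N.stopAt L i = f.2)).filterMap fun i =>
            ((N.tripsOf L).find? (fun T => τ + N.walk p f.2 ≤ N.dep T i)).map fun T =>
              ⟨Segment.first, T, i, [(ids.footpath f : ℤ), (ids.line L : ℤ), (i : ℤ), N.dep T 1]⟩
  | .fromEvent T i => [⟨Segment.first, T, i, []⟩]

variable {N : Network Stop Line Trip} {ids : IDs Stop Line Trip} {𝔗 : Finset (Transfer Trip)}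
  {Q : Query Stop Trip} {scheme : Scheme}

lemma initialFrontier_eq (src : Source Stop Trip) :
    N.initialFrontier ids src = (N.initialRequests ids src).foldl N.serve N.emptyFrontier := by
  cases src with
  | fromEvent T i => rfl
  | fromStop p τ =>
    simp only [initialFrontier, initialRequests, List.foldl_flatMap, List.foldl_filterMap]
    congr! 9 with F f F' L F'' i
    cases (N.tripsOf L).find? (fun T => τ + N.walk p f.2 ≤ N.dep T i) <;> rfl

omit [Fintype Line] [DecidableEq Stop] [DecidableEq Trip] in
-- The list is sorted by departure at index `1`, which is the total order of the line, although the
-- departure test concerns index `i`.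
lemma find_tripsOf {L : Line} {i : ℕ} {θ : ℤ} {T : Trip}
    (hT : N.line T = L) (h : θ ≤ N.dep T i) :
    ∃ S, (N.tripsOf L).find? (fun T => θ ≤ N.dep T i) = some S ∧ N.TripLE S T := by
  have hmem : ∀ {S}, S ∈ N.tripsOf L ↔ N.line S = L := by simp [tripsOf, mem_sortBy]
  have hs : ((N.tripsOf L).find? (fun T => θ ≤ N.dep T i)).isSome := by
    rw [List.find?_isSome]
    exact ⟨T, hmem.2 hT, by simpa using h⟩
  obtain ⟨S, hS⟩ := Option.isSome_iff_exists.1 hs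
  refine ⟨S, hS, ?_⟩
  have hSl := hmem.1 (List.mem_of_find?_eq_some hS)
  obtain ⟨-, as, bs, h2, h3⟩ := List.find?_eq_some_iff_append.1 hS
  have hp : (N.tripsOf L).Pairwise (fun S S' => N.dep S 1 ≤ N.dep S' 1) := pairwise_sortBy _ _
  have hTm := hmem.2 hT
  rw [h2] at hp hTm
  rcases List.mem_append.1 hTm with hm | hm
  · exact absurd h (by simpa using h3 T hm)
  · rcases List.mem_cons.1 hm with rfl | hm
    · exact .refl _
    · exact tripLE_of_dep_le (hSl.trans hT.symm) le_rfl (N.len_pos _)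
        ((List.pairwise_cons.1 (List.pairwise_append.1 hp).2.1).1 T hm)

omit [DecidableEq Trip] in
lemma mem_initialRequests {p : Stop} {τ : ℤ} {r : Request Trip} :
    r ∈ N.initialRequests ids (.fromStop p τ) ↔ ∃ i T, 1 ≤ i ∧ i ≤ N.len (N.line T) ∧
      (p, N.evStop (T, i)) ∈ N.footpaths ∧
      (N.tripsOf (N.line T)).find? (fun T' => τ + N.walk p (N.evStop (T, i)) ≤ N.dep T' i) =
        some T ∧
      r = ⟨Segment.first, T, i, [(ids.footpath (p, N.evStop (T, i)) : ℤ),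
        (ids.line (N.line T) : ℤ), (i : ℤ), N.dep T 1]⟩ := by
  simp only [initialRequests, List.mem_flatMap, mem_sortBy, Finset.mem_filter, Finset.mem_univ,
    true_and, List.mem_filterMap, List.mem_filter, List.mem_range'_1, decide_eq_true_eq,
    Option.map_eq_some_iff]
  constructor
  · rintro ⟨⟨_, q⟩, ⟨hf, rfl⟩, L, i, ⟨hi, hq⟩, T, hT, rfl⟩
    simp only at hq
    subst hq
    have hL : N.line T = L := by
      have := List.mem_of_find?_eq_some hT
      simpa [tripsOf, mem_sortBy] using this
    subst hL
    exact ⟨i, T, hi.1, by omega, hf, hT, rfl⟩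
  · rintro ⟨i, T, hi, hi', hf, hT, rfl⟩
    exact ⟨(p, N.evStop (T, i)), ⟨hf, rfl⟩, N.line T, i, ⟨by omega, rfl⟩, T, hT, rfl⟩

omit [DecidableEq Trip] in
lemma pairwise_initialRequests (hf : Set.InjOn ids.footpath N.footpaths)
    (hL : Function.Injective ids.line) (src : Source Stop Trip) :
    (N.initialRequests ids src).Pairwise (fun r r' => r.key < r'.key) := by
  cases src with
  | fromEvent T i => exact List.pairwise_singleton _ _
  | fromStop p τ =>
    rw [initialRequests, List.pairwise_flatMap]
    refine ⟨fun f _ => ?_, (pairwise_lt_sortBy (hf.mono ?_)).imp fun {f f'} h => ?_⟩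
    · rw [List.pairwise_flatMap]
      refine ⟨fun L _ => ?_, (pairwise_lt_sortBy hL.injOn).imp fun {L L'} h => ?_⟩
      · rw [List.pairwise_filterMap]
        refine ((List.pairwise_lt_range' (s := 1) 1).filter _).imp fun {i i'} h => ?_
        simp only [Option.map_eq_some_iff, forall_exists_index, and_imp]
        rintro _ T - rfl _ T' - rfl
        simp [List.cons_lt_cons_iff, h]
      · simp only [List.mem_filterMap, Option.map_eq_some_iff, forall_exists_index, and_imp]
        rintro _ i - T - rfl _ i' - T' - rfl
        simp [List.cons_lt_cons_iff, h]
    · intro f hf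
      exact (Finset.mem_filter.1 hf).1
    · simp only [List.mem_flatMap, List.mem_filterMap, Option.map_eq_some_iff,
        forall_exists_index, and_imp]
      rintro _ L - i - T - rfl _ L' - i' - T' - rfl
      simp [List.cons_lt_cons_iff, h]

lemma exists_served_initial (hids : N.ValidIDs ids 𝔗)
    (hQ : ∀ T i, Q.source = .fromEvent T i → 1 ≤ i) :
    ∃ acc, Served N N.emptyFrontier (N.initialFrontier ids Q.source)
      (N.initialRequests ids Q.source) acc ∧ N.Sound ids 𝔗 Q 1 acc ∧
      N.FrontierInv ids 𝔗 Q 1 (N.initialFrontier ids Q.source) := by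
  have hp := pairwise_initialRequests hids.1 hids.2.1 Q.source
  obtain ⟨acc, h⟩ := exists_served (N := N) N.emptyFrontier _ hp
  rw [← initialFrontier_eq] at h
  have hs : N.Sound ids 𝔗 Q 1 acc := by
    rintro ⟨r, last⟩ hx
    have hr : r ∈ N.initialRequests ids Q.source :=
      h.sublist.subset (List.mem_map_of_mem hx)
    have hlast := (h.lt_reached _ hx).2
    simp only [emptyFrontier] at hlast
    cases hsrc : Q.source with
    | fromEvent T i =>
      rw [hsrc] at hr
      obtain rfl := List.mem_singleton.1 hr
      exact ⟨.of_event hsrc (hQ T i hsrc) (by dsimp only at hlast ⊢; omega), rfl, rfl, rfl⟩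
    | fromStop p τ =>
      rw [hsrc] at hr
      obtain ⟨i, T, hi, hi', hf, hT, rfl⟩ := mem_initialRequests.1 hr
      refine ⟨.of_source hsrc hi (by dsimp only at hlast ⊢; omega) hf ?_, rfl, rfl, rfl⟩
      simpa using List.find?_some hT
  exact ⟨acc, h, hs, h.frontierInv rfl hp hs (fun T => le_rfl) fun T => .inl rfl⟩

/-- The first trip segment of a minimal representative is found. -/
lemma exists_mem_initial_queue (h𝔗 : N.IsTransferSet scheme 𝔗) (hids : N.ValidIDs ids 𝔗)
    (hQ : ∀ T i, Q.source = .fromEvent T i → 1 ≤ i) {c : ℤ × ℕ}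
    (hc : c ∈ N.paretoFront Q) (hex : N.Unexceptional scheme Q c) {J : List (Leg Trip)}
    {x : Leg Trip} (hmin : N.IsMinimalRep ids 𝔗 Q c (x :: J)) :
    ∃ i, x.exit ≤ i ∧ Segment.first x.trip x.board i ∈ (N.initialFrontier ids Q.source).queue := by
  obtain ⟨acc, h, hacc, -⟩ := exists_served_initial (N := N) (Q := Q) hids hQ
  have h0 : N.LeadsFrom Q.target c.1 Q.source ([] ++ x :: J) :=
    leadsFrom_iff.2 ⟨hmin.1.1, by rw [List.nil_append, hmin.2.1]⟩
  have hx := h0.rest.1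
  cases hsrc : Q.source with
  | fromEvent T i =>
    rw [hsrc] at h0 h
    obtain ⟨rfl, rfl, -⟩ := h0
    have hmem : (⟨Segment.first, x.trip, x.board, []⟩ : Request Trip) ∈
      N.initialRequests ids (.fromEvent x.trip x.board) := List.mem_singleton_self _
    -- There is a single request and no trip has been reached before, so nothing can block it.
    -- `not_preempted` is avoided here since it does not cover the first leg of an event-based query
    -- in Witt's scheme.
    rcases h.served _ hmem x.exit hx.2.1 with ⟨i, hi, hi'⟩ | h' | ⟨y, hy, hy1, -⟩
    · exact ⟨i, hi, h.seg_mem_queue hi'⟩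
    · have := hx.2.2
      simp only [emptyFrontier] at h'
      omega
    · have := h.sublist.subset (List.mem_map_of_mem hy)
      rw [List.mem_singleton.1 this] at hy1
      exact absurd hy1 (lt_irrefl _)
  | fromStop p τ =>
    rw [hsrc] at h0
    obtain ⟨hf, hd, -⟩ := h0
    have hbl : x.board ≤ N.len (N.line x.trip) := hx.2.1.le.trans hx.2.2
    obtain ⟨S, hS, hle⟩ := find_tripsOf rfl hd
    have hne : scheme = .witt → ∀ T i, Q.source = .fromEvent T i → ([] : List (Leg Trip)) ≠ [] := by
      simp [hsrc]
    have hmin' : N.IsMinimalRep ids 𝔗 Q c ([] ++ x :: J) := hmin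
    have hSd : τ + N.walk p (N.evStop (x.trip, x.board)) ≤ N.dep S x.board := by
      simpa using List.find?_some hS
    rcases hle with hlt | rfl
    -- A strictly earlier trip that can be entered at the same index has the smaller departure at
    -- index `1`, hence the smaller key.
    · exfalso
      have hle : N.TripLE S x.trip := .inl hlt
      have hv : N.Valid 𝔗 Q 1 (.first S x.board x.board) :=
        .of_source hsrc hx.1 (hle.line_eq ▸ hbl) (hle.evStop_eq _ ▸ hf) (hle.evStop_eq _ ▸ hSd)
      refine not_preempted (k := [(ids.footpath (p, N.evStop (x.trip, x.board)) : ℤ),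
        (ids.line (N.line x.trip) : ℤ), (x.board : ℤ), N.dep x.trip 1])
        (l := (x.exit : ℤ) :: tiebreakTail ids x J) h𝔗 hc hex hmin' ?_ hv hle hx.2.1 hne
        (.inr ⟨rfl, ?_, ?_⟩)
      · simp [tiebreak, hsrc, tiebreakHead]
      · have := (hlt.2 1 le_rfl (N.len_pos _)).2
        simp [hsrc, segKey, hle.evStop_eq, hle.line_eq, List.cons_lt_cons_iff, this]
      · simp [hsrc, segKey]
    · have hmem := mem_initialRequests (ids := ids).2 ⟨x.board, x.trip, hx.1, hbl, hf, hS, rfl⟩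
      rw [← hsrc] at hmem ⊢
      have hkl : ∀ y ∈ acc, y.1.key.length = 4 := fun y hy => by
        have := h.sublist.subset (List.mem_map_of_mem hy)
        rw [hsrc] at this
        obtain ⟨i, T, -, -, -, -, he⟩ := mem_initialRequests.1 this
        rw [he]
        rfl
      obtain ⟨i, hi, hi'⟩ := h.exists_mem_acc h𝔗 hc hex hmin' hne hacc (fun T => .inl rfl) hmem rfl
        rfl (k := (x.exit : ℤ) :: tiebreakTail ids x J) (by simp [tiebreak, hsrc, tiebreakHead]) hkl
      exact ⟨i, hi, h.seg_mem_queue hi'⟩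

end Initial

end Network

namespace Network

/-! ### Minimal representatives -/

section Minimal

variable {N : Network Stop Line Trip} {ids : IDs Stop Line Trip} {𝔗 : Finset (Transfer Trip)}
  {Q : Query Stop Trip}

lemma tiebreakTail_inj (hids : Set.InjOn ids.transfer 𝔗) {a : Leg Trip} {J J' : List (Leg Trip)}
    (hJ : (a :: J).IsChain (fun a b : Leg Trip => ((a.trip, a.exit), (b.trip, b.board)) ∈ 𝔗))
    (hJ' : (a :: J').IsChain (fun a b : Leg Trip => ((a.trip, a.exit), (b.trip, b.board)) ∈ 𝔗))
    (h : tiebreakTail ids a J = tiebreakTail ids a J') : J = J' := by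
  induction J generalizing a J' with
  | nil =>
    cases J' with
    | nil => rfl
    | cons b J' => simp [tiebreakTail] at h
  | cons b J ih =>
    cases J' with
    | nil => simp [tiebreakTail] at h
    | cons b' J' =>
      simp only [tiebreakTail, List.cons.injEq, Nat.cast_inj] at h
      rw [List.isChain_cons_cons] at hJ hJ'
      obtain ⟨h1, h2, h3⟩ := h
      have h4 := hids hJ.1 hJ'.1 h1
      simp only [Prod.mk.injEq, true_and] at h4
      obtain rfl : b = b' := by
        cases b
        cases b'
        simp_all
      rw [ih hJ.2 hJ'.2 h3]

lemma tiebreak_injOn (hids : N.ValidIDs ids 𝔗) :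
    Set.InjOn (N.tiebreak ids Q.source) (N.journeysIn Q 𝔗) := by
  intro J hJ J' hJ' h
  cases J with
  | nil => exact absurd rfl hJ.1.1.1
  | cons s J =>
  cases J' with
  | nil => exact absurd rfl hJ'.1.1.1
  | cons s' J' =>
  have hs := hJ.1.2.1 s rfl
  have hs' := hJ'.1.2.1 s' rfl
  cases hsrc : Q.source with
  | fromEvent T i =>
    simp only [hsrc, tiebreak, tiebreakHead, StartsAt, List.cons_append, List.nil_append,
      List.cons.injEq, Nat.cast_inj] at h hs hs'
    obtain ⟨-, h1, h2⟩ := h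
    obtain rfl : s = s' := by
      cases s
      cases s'
      simp_all
    rw [tiebreakTail_inj hids.2.2 hJ.2 hJ'.2 h2]
  | fromStop p τ =>
    simp only [hsrc, tiebreak, tiebreakHead, List.cons_append, List.nil_append,
      List.cons.injEq, Nat.cast_inj] at h
    obtain ⟨-, -, h1, h2, h3, h4, h5⟩ := h
    -- Distinct trips of a line depart at different times at index `1`.
    have ht : s.trip = s'.trip := by
      by_contra hne
      rcases N.line_total _ _ (hids.2.1 h1) hne with h' | h' <;>
      · have := (h' 1 le_rfl (N.len_pos _)).2
        omega
    obtain rfl : s = s' := by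
      cases s
      cases s'
      simp_all
    rw [tiebreakTail_inj hids.2.2 hJ.2 hJ'.2 h5]

lemma finite_legOK [Finite Trip] : {s : Leg Trip | N.LegOK s}.Finite := by
  refine (Set.finite_iUnion fun T : Trip => ((Set.finite_Iic (N.len (N.line T))).prod
    (Set.finite_Iic (N.len (N.line T)))).image fun x => (⟨T, x.1, x.2⟩ : Leg Trip)).subset ?_
  rintro ⟨T, b, e⟩ ⟨-, h1, h2⟩
  exact Set.mem_iUnion.2 ⟨T, (b, e), ⟨h1.le.trans h2, h2⟩, rfl⟩

lemma finite_journeys [Finite Trip] (k : ℕ) :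
    {J : List (Leg Trip) | J.length = k ∧ ∀ s ∈ J, N.LegOK s}.Finite := by
  have : Finite {s : Leg Trip | N.LegOK s} := finite_legOK
  refine ((List.finite_length_eq {s : Leg Trip | N.LegOK s} k).image
    (List.map Subtype.val)).subset ?_
  rintro J ⟨hk, hJ⟩
  lift J to List {s : Leg Trip | N.LegOK s} using hJ
  exact ⟨J, (List.length_map _).symm.trans hk, rfl⟩

/-- A cost vector fixes the number of legs, which leaves finitely many journeys. Injectivity of the
tiebreaking sequence makes the minimum strict. -/
lemma exists_isMinimalRep [Finite Trip] (hids : N.ValidIDs ids 𝔗) {c : ℤ × ℕ}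
    (h : ∃ J ∈ N.journeysIn Q 𝔗, N.cost Q.target J = c) :
    ∃ J, N.IsMinimalRep ids 𝔗 Q c J := by
  have hfin : {J | J ∈ N.journeysIn Q 𝔗 ∧ N.cost Q.target J = c}.Finite := by
    refine (finite_journeys (N := N) c.2).subset ?_
    rintro J ⟨hJ, rfl⟩
    exact ⟨(cost_snd hJ.1.1.1).symm, hJ.1.1.2.1⟩
  obtain ⟨J, hJ, hmin⟩ := Set.exists_min_image _ (N.tiebreak ids Q.source) hfin h
  refine ⟨J, hJ.1, hJ.2, fun J' hJ' hc hne => ?_⟩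
  exact lt_of_le_of_ne (hmin J' ⟨hJ', hc⟩) fun he => hne (tiebreak_injOn hids hJ.1 hJ' he).symm

/-- The precomputed transfers preserve the Pareto front. -/
lemma exists_journeysIn [Finite Trip] {scheme : Scheme} (h𝔗 : N.IsTransferSet scheme 𝔗)
    {c : ℤ × ℕ} (hc : c ∈ N.paretoFront Q) (hex : N.Unexceptional scheme Q c)
    (hev : scheme = .witt → ∀ T i, Q.source = .fromEvent T i →
      ∃ J ∈ N.journeysIn Q 𝔗, N.cost Q.target J = c) :
    ∃ J ∈ N.journeysIn Q 𝔗, N.cost Q.target J = c := by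
  -- This is the one case in which the first leg cannot be repaired, so existence is taken from
  -- `hev`.
  by_cases h : scheme = .witt ∧ ∃ T i, Q.source = .fromEvent T i
  · obtain ⟨hw, T, i, hT⟩ := h
    exact hev hw T i hT
  obtain ⟨⟨J, hJ, hJc⟩, -⟩ := id hc
  cases J with
  | nil => exact absurd rfl hJ.1.1
  | cons s J =>
  obtain ⟨j', J', h1, h2⟩ := exists_replacement h𝔗 hc hex le_rfl J [] s.trip s.board s.exit
    (leadsFrom_iff.2 ⟨hJ, by rw [← hJc]; rfl⟩)
    (by rw [← hJc, cost_snd (by simp)]; rfl)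
    (fun hw T i hT => absurd ⟨hw, T, i, hT⟩ h) (fun j => List.isChain_singleton _)
  exact ⟨_, h1, h2⟩

end Minimal

/-! ### The tentative Pareto front -/

section Fronts

variable [DecidableEq Trip]

/-- The arrival time at the target stop if the segment `s` is left at the index `i`. -/
def arrivalAt (N : Network Stop Line Trip) (target : Stop) (s : Segment Trip) (i : ℕ) : ℤ :=
  N.arr s.trip i + N.walk (N.evStop (s.trip, i)) target

/-- The segment `s`, left at the index `i`, leads to the target of the query with `m` trips. -/
structure Arrives (N : Network Stop Line Trip) (𝔗 : Finset (Transfer Trip)) (Q : Query Stop Trip)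
    (m : ℕ) (s : Segment Trip) (i : ℕ) : Prop where
  valid : N.Valid 𝔗 Q m s
  board_lt : s.board < i
  le_len : i ≤ N.len (N.line s.trip)
  footpath : (N.evStop (s.trip, i), Q.target) ∈ N.footpaths

/-- The entries belong to journeys, with decreasing arrival times that are not less than `tmin`. -/
structure FrontInv (N : Network Stop Line Trip) (𝔗 : Finset (Transfer Trip)) (Q : Query Stop Trip)
    (P : Front Trip) : Prop where
  arrives : ∀ e ∈ P.entries, N.Arrives 𝔗 Q e.cost.2 e.seg e.exit ∧
    e.cost.1 = N.arrivalAt Q.target e.seg e.exit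
  sorted : P.entries.Pairwise (fun e e' => e'.cost.1 < e.cost.1)
  tmin_le : ∀ e ∈ P.entries, P.tmin ≤ (e.cost.1 : WithTop ℤ)

variable {N : Network Stop Line Trip} {ids : IDs Stop Line Trip} {𝔗 : Finset (Transfer Trip)}
  {Q : Query Stop Trip} {m : ℕ} {s : Segment Trip} {i : ℕ} {c : ℤ × ℕ}

lemma Arrives.leadsFrom (h : N.Arrives 𝔗 Q m s i) {A : ℤ} (hA : N.arrivalAt Q.target s i ≤ A) :
    N.LeadsFrom Q.target A Q.source (unpack 𝔗 s i) := by
  have := h.valid.leads i [] A h.board_lt h.le_len ⟨h.footpath, hA⟩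
  rwa [List.append_nil] at this

lemma Arrives.mem_journeysIn (h : N.Arrives 𝔗 Q m s i) : unpack 𝔗 s i ∈ N.journeysIn Q 𝔗 :=
  ⟨(leadsFrom_iff.1 (h.leadsFrom le_rfl)).1, h.valid.chain i⟩

lemma Arrives.cost_eq (h : N.Arrives 𝔗 Q m s i) :
    N.cost Q.target (unpack 𝔗 s i) = (N.arrivalAt Q.target s i, m) := by
  rw [← h.valid.length i]
  simp [cost, unpack_eq, arrivalAt]

lemma Arrives.not_dominates (h : N.Arrives 𝔗 Q m s i) (hc : c ∈ N.paretoFront Q) :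
    ¬ Dominates (N.arrivalAt Q.target s i, m) c := by
  rw [← h.cost_eq]
  exact hc.2 _ h.mem_journeysIn.1

variable [DecidableEq Stop] {tp : Bool}

omit [DecidableEq Trip] in
lemma scanEvents_cons (target : Stop) (is : List ℕ) (P : Front Trip) :
    N.scanEvents tp target m s (i :: is) P =
      if tp ∧ P.tmin ≤ (N.arr s.trip i : WithTop ℤ) then P
      else if (N.evStop (s.trip, i), target) ∈ N.footpaths ∧
          (N.arrivalAt target s i : WithTop ℤ) < P.tmin then
        N.scanEvents tp target m s is
          { tmin := N.arrivalAt target s i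
            entries := P.entries.filter
              (fun e => ¬ Dominates (N.arrivalAt target s i, m) e.cost) ++
                [⟨(N.arrivalAt target s i, m), s, i⟩] }
      else N.scanEvents tp target m s is P := rfl

omit [DecidableEq Trip] in
lemma lt_tmin_scanEvents {target : Stop} {is : List ℕ} {P : Front Trip} {a : ℤ}
    (hP : (a : WithTop ℤ) < P.tmin)
    (h : ∀ i ∈ is, (N.evStop (s.trip, i), target) ∈ N.footpaths → a < N.arrivalAt target s i) :
    (a : WithTop ℤ) < (N.scanEvents tp target m s is P).tmin := by
  induction is generalizing P with
  | nil => exact hP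
  | cons i is ih =>
    rw [List.forall_mem_cons] at h
    rw [scanEvents_cons]
    split_ifs with h1 h2
    · exact hP
    · exact ih (WithTop.coe_lt_coe.2 (h.1 h2.1)) h.2
    · exact ih hP h.2

lemma FrontInv.scanEvents {is : List ℕ} {P : Front Trip} (hP : N.FrontInv 𝔗 Q P)
    (hs : N.Valid 𝔗 Q m s) (his : is ⊆ s.indices) :
    N.FrontInv 𝔗 Q (N.scanEvents tp Q.target m s is P) := by
  induction is generalizing P with
  | nil => exact hP
  | cons i is ih =>
    rw [List.cons_subset] at his
    rw [scanEvents_cons]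
    split_ifs with h1 h2
    · exact hP
    · have hi := Segment.mem_indices.1 his.1
      have hlt : ∀ e ∈ P.entries, N.arrivalAt Q.target s i < e.cost.1 := fun e he =>
        WithTop.coe_lt_coe.1 (h2.2.trans_le (hP.tmin_le e he))
      refine ih ⟨?_, ?_, ?_⟩ his.2
      · intro e he
        rcases List.mem_append.1 he with he | he
        · exact hP.arrives e (List.mem_of_mem_filter he)
        · rw [List.mem_singleton.1 he]
          exact ⟨⟨hs, hi.1, hi.2.trans hs.last_le, h2.1⟩, rfl⟩
      · refine List.pairwise_append.2 ⟨hP.sorted.filter _, List.pairwise_singleton _ _, ?_⟩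
        intro e he e' he'
        rw [List.mem_singleton.1 he']
        exact hlt e (List.mem_of_mem_filter he)
      · intro e he
        rcases List.mem_append.1 he with he | he
        · exact WithTop.coe_le_coe.2 (hlt e (List.mem_of_mem_filter he)).le
        · rw [List.mem_singleton.1 he]
    · exact ih hP his.2

omit [DecidableEq Trip] in
-- An entry is deleted only when a new cost vector dominates it; pruning merely ends the scan.
lemma mem_scanEvents_of_mem {target : Stop} {is : List ℕ} {P : Front Trip} {e : Entry Trip}
    (he : e ∈ P.entries) (h : ∀ i ∈ is, (N.evStop (s.trip, i), target) ∈ N.footpaths →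
      ¬ Dominates (N.arrivalAt target s i, m) e.cost) :
    e ∈ (N.scanEvents tp target m s is P).entries := by
  induction is generalizing P with
  | nil => exact he
  | cons i is ih =>
    rw [List.forall_mem_cons] at h
    rw [scanEvents_cons]
    split_ifs with h1 h2
    · exact he
    · refine ih (List.mem_append_left _ (List.mem_filter.2 ⟨he, ?_⟩)) h.2
      simpa only [decide_eq_true_eq] using h.1 h2.1
    · exact ih he h.2

omit [DecidableEq Trip] in
-- `hlt` keeps `tmin` above the arrival time of `j` until `j` is scanned, `harr` prevents target
-- pruning up to then, and `hdom` protects the entry afterwards.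
lemma mem_scanEvents {target : Stop} {is : List ℕ} (his : is.Pairwise (· < ·)) {j : ℕ}
    (hj : j ∈ is) {P : Front Trip} (hf : (N.evStop (s.trip, j), target) ∈ N.footpaths)
    (hP : (N.arrivalAt target s j : WithTop ℤ) < P.tmin)
    (hlt : ∀ i ∈ is, i < j → (N.evStop (s.trip, i), target) ∈ N.footpaths →
      N.arrivalAt target s j < N.arrivalAt target s i)
    (harr : ∀ i ∈ is, i ≤ j → N.arr s.trip i ≤ N.arrivalAt target s j)
    (hdom : ∀ i ∈ is, (N.evStop (s.trip, i), target) ∈ N.footpaths →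
      ¬ Dominates (N.arrivalAt target s i, m) (N.arrivalAt target s j, m)) :
    ⟨(N.arrivalAt target s j, m), s, j⟩ ∈ (N.scanEvents tp target m s is P).entries := by
  induction is generalizing P with
  | nil => simp at hj
  | cons i is ih =>
    rw [List.pairwise_cons] at his
    rw [List.forall_mem_cons] at hlt harr hdom
    have hij : i ≤ j := by
      rcases List.mem_cons.1 hj with rfl | hj
      exacts [le_rfl, (his.1 j hj).le]
    rw [scanEvents_cons, if_neg]
    swap
    · rintro ⟨-, h⟩
      exact absurd (hP.trans_le (h.trans (WithTop.coe_le_coe.2 (harr.1 hij)))) (lt_irrefl _)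
    rcases List.mem_cons.1 hj with rfl | hj
    · rw [if_pos ⟨hf, hP⟩]
      exact mem_scanEvents_of_mem (by simp) hdom.2
    · split_ifs with h2
      · exact ih his.2 hj (WithTop.coe_lt_coe.2 (hlt.1 (his.1 j hj) h2.1)) hlt.2 harr.2 hdom.2
      · exact ih his.2 hj hP hlt.2 harr.2 hdom.2

/-- The first loop of a round. -/
noncomputable def scanQueue (N : Network Stop Line Trip) (tp : Bool) (target : Stop) (m : ℕ)
    (queue : List (Segment Trip)) (P : Front Trip) : Front Trip :=
  queue.foldl (fun P s => N.scanEvents tp target m s s.indices P) P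

omit [DecidableEq Trip] in
lemma lt_tmin_scanQueue {target : Stop} {queue : List (Segment Trip)} {P : Front Trip} {a : ℤ}
    (hP : (a : WithTop ℤ) < P.tmin)
    (h : ∀ s ∈ queue, ∀ i ∈ s.indices, (N.evStop (s.trip, i), target) ∈ N.footpaths →
      a < N.arrivalAt target s i) :
    (a : WithTop ℤ) < (N.scanQueue tp target m queue P).tmin := by
  induction queue generalizing P with
  | nil => exact hP
  | cons s queue ih =>
    rw [List.forall_mem_cons] at h
    exact ih (lt_tmin_scanEvents hP h.1) h.2

lemma FrontInv.scanQueue {queue : List (Segment Trip)} {P : Front Trip} (hP : N.FrontInv 𝔗 Q P)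
    (hs : ∀ s ∈ queue, N.Valid 𝔗 Q m s) :
    N.FrontInv 𝔗 Q (N.scanQueue tp Q.target m queue P) := by
  induction queue generalizing P with
  | nil => exact hP
  | cons s queue ih =>
    rw [List.forall_mem_cons] at hs
    exact ih (hP.scanEvents hs.1 (List.Subset.refl _)) hs.2

lemma mem_scanQueue_of_mem {queue : List (Segment Trip)} {P : Front Trip} {e : Entry Trip}
    (he : e ∈ P.entries) (hc : e.cost ∈ N.paretoFront Q)
    (hs : ∀ s ∈ queue, N.Valid 𝔗 Q m s) :
    e ∈ (N.scanQueue tp Q.target m queue P).entries := by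
  induction queue generalizing P with
  | nil => exact he
  | cons s queue ih =>
    rw [List.forall_mem_cons] at hs
    refine ih (mem_scanEvents_of_mem he fun i hi hf => ?_) hs.2
    have hi := Segment.mem_indices.1 hi
    exact Arrives.not_dominates ⟨hs.1, hi.1, hi.2.trans hs.1.last_le, hf⟩ hc

/-- When its final segment is scanned, a minimal representative is stored. -/
lemma mem_scanQueue (hc : c ∈ N.paretoFront Q) {queue : List (Segment Trip)}
    (hqs : queue.Pairwise (fun s s' => N.segKey ids 𝔗 Q.source s < N.segKey ids 𝔗 Q.source s'))
    (hqv : ∀ s ∈ queue, N.Valid 𝔗 Q m s) {P : Front Trip} (hP : (c.1 : WithTop ℤ) < P.tmin)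
    (hs : s ∈ queue) {j : ℕ} (hj : j ∈ s.indices)
    (hmin : N.IsMinimalRep ids 𝔗 Q c (unpack 𝔗 s j)) :
    ⟨c, s, j⟩ ∈ (N.scanQueue tp Q.target m queue P).entries := by
  have hfj : (N.evStop (s.trip, j), Q.target) ∈ N.footpaths := by
    refine hmin.1.1.2.2 ⟨s.trip, s.board, j⟩ ?_
    simp [unpack_eq]
  have harr : ∀ s' ∈ queue, ∀ i ∈ s'.indices,
      (N.evStop (s'.trip, i), Q.target) ∈ N.footpaths → N.Arrives 𝔗 Q m s' i :=
    fun s' hs' i hi hf => ⟨hqv s' hs', (Segment.mem_indices.1 hi).1,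
      (Segment.mem_indices.1 hi).2.trans (hqv s' hs').last_le, hf⟩
  have hcost := (harr s hs j hj hfj).cost_eq
  rw [hmin.2.1] at hcost
  -- An arrival by `c.1` with the same number of trips has exactly the cost `c`, so a smaller
  -- tiebreaking sequence contradicts minimality.
  have hearlier : ∀ s' ∈ queue, ∀ i ∈ s'.indices,
      (N.evStop (s'.trip, i), Q.target) ∈ N.footpaths →
      N.tiebreak ids Q.source (unpack 𝔗 s' i) < N.tiebreak ids Q.source (unpack 𝔗 s j) →
      c.1 < N.arrivalAt Q.target s' i := by
    intro s' hs' i hi hf hlt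
    by_contra hle
    have h := harr s' hs' i hi hf
    refine not_precedes_of_isMinimalRep hmin h.mem_journeysIn ?_ hlt
    refine pareto_cost_eq hc (h.leadsFrom (not_lt.1 hle)) le_rfl ?_
    rw [h.valid.length, hcost]
  have htb : ∀ s' ∈ queue, ∀ i, N.tiebreak ids Q.source (unpack 𝔗 s' i) =
      (m : ℤ) :: (N.segKey ids 𝔗 Q.source s' ++ [(i : ℤ)]) := by
    intro s' hs' i
    have := tiebreak_unpack (N := N) (ids := ids) (𝔗 := 𝔗) (src := Q.source) s' i []
    simpa [tiebreakTail, (hqv s' hs').length] using this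
  obtain ⟨q₁, q₂, rfl⟩ := List.append_of_mem hs
  have hsplit : N.scanQueue tp Q.target m (q₁ ++ s :: q₂) P = N.scanQueue tp Q.target m q₂
      (N.scanEvents tp Q.target m s s.indices (N.scanQueue tp Q.target m q₁ P)) := by
    simp [scanQueue]
  rw [hsplit]
  refine mem_scanQueue_of_mem (e := ⟨c, s, j⟩) ?_ hc fun s' hs' => hqv s' (by simp [hs'])
  have ha : c.1 = N.arrivalAt Q.target s j := by rw [hcost]
  -- The segments scanned before `s` have smaller keys, so none of them reaches the target by `c.1`.
  have ht : (c.1 : WithTop ℤ) < (N.scanQueue tp Q.target m q₁ P).tmin := by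
    refine lt_tmin_scanQueue hP fun s' hs' i hi hf => ?_
    refine hearlier s' (by simp [hs']) i hi hf ?_
    rw [htb s' (by simp [hs']), htb s hs, List.cons_lt_cons_iff]
    exact .inr ⟨rfl, append_lt_append ((List.pairwise_append.1 hqs).2.2 s' hs' s (by simp))
      ((hqv s' (by simp [hs'])).segKey_length_eq ids (hqv s hs)) _ _⟩
  rw [hcost]
  refine mem_scanEvents s.pairwise_indices hj hfj (ha ▸ ht) (fun i hi hij hf => ?_)
    (fun i hi hij => ?_) fun i hi hf => ?_
  · rw [← ha]
    refine hearlier s hs i hi hf ?_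
    rw [htb s hs, htb s hs, List.cons_lt_cons_iff]
    exact .inr ⟨rfl, append_lt_append_left (by simp [List.cons_lt_cons_iff, hij])⟩
  · have h1 : N.arr s.trip i ≤ N.arr s.trip j := arr_mono
      (by have := (Segment.mem_indices.1 hi).1; omega) hij
      ((Segment.mem_indices.1 hj).2.trans (hqv s hs).last_le)
    unfold arrivalAt
    omega
  · exact hcost ▸ (harr s hs i hi hf).not_dominates hc

end Fronts

/-! ### The search -/

section Search

variable [DecidableEq Stop] [DecidableEq Line] [Fintype Line] [DecidableEq Trip] [Fintype Trip]

variable {N : Network Stop Line Trip} {ids : IDs Stop Line Trip} {𝔗 : Finset (Transfer Trip)}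
  {Q : Query Stop Trip} {scheme : Scheme} {tp : Bool} {c : ℤ × ℕ}

omit [DecidableEq Stop] [DecidableEq Line] [Fintype Line] [DecidableEq Trip] [Fintype Trip] in
lemma keptIndices_subset (tmin : WithTop ℤ) (s : Segment Trip) :
    N.keptIndices tp tmin s ⊆ s.indices := by
  unfold keptIndices
  split_ifs
  exacts [(List.takeWhile_prefix _).subset, List.Subset.refl _]

omit [DecidableEq Stop] [DecidableEq Line] [Fintype Line] [DecidableEq Trip] [Fintype Trip] in
lemma pairwise_keptIndices (tmin : WithTop ℤ) (s : Segment Trip) :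
    (N.keptIndices tp tmin s).Pairwise (· < ·) := by
  unfold keptIndices
  split_ifs
  exacts [s.pairwise_indices.sublist (List.takeWhile_prefix _).sublist, s.pairwise_indices]

omit [DecidableEq Stop] [DecidableEq Line] [Fintype Line] [DecidableEq Trip] [Fintype Trip] in
lemma mem_keptIndices_of_lt (tmin : WithTop ℤ) (s : Segment Trip) (i : ℕ)
    (hi : i ∈ N.keptIndices tp tmin s) (e : ℕ) (he : e ∈ s.indices) (h : e < i) :
    e ∈ N.keptIndices tp tmin s := by
  unfold keptIndices at hi ⊢
  split_ifs at hi ⊢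
  exacts [mem_takeWhile_of_lt s.pairwise_indices hi he h, he]

omit [DecidableEq Stop] [DecidableEq Line] [Fintype Line] [DecidableEq Trip] [Fintype Trip] in
lemma mem_keptIndices {tmin : WithTop ℤ} {s : Segment Trip} {j : ℕ} (hj : j ∈ s.indices)
    (hl : s.last ≤ N.len (N.line s.trip)) (h : (N.arr s.trip j : WithTop ℤ) < tmin) :
    j ∈ N.keptIndices tp tmin s := by
  unfold keptIndices
  split_ifs
  · refine mem_takeWhile s.pairwise_indices hj (by simpa using h) fun i hi hij => ?_
    have h1 : N.arr s.trip i ≤ N.arr s.trip j := arr_mono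
      (by have := (Segment.mem_indices.1 hi).1; omega) hij.le
      ((Segment.mem_indices.1 hj).2.trans hl)
    simpa using (WithTop.coe_le_coe.2 h1).trans_lt h
  · exact hj

lemma search_succ_front (n : ℕ) : (N.search 𝔗 ids tp Q (n + 1)).front =
    N.scanQueue tp Q.target (n + 1) (N.search 𝔗 ids tp Q n).frontier.queue
      (N.search 𝔗 ids tp Q n).front := rfl

lemma search_succ_frontier (n : ℕ) : (N.search 𝔗 ids tp Q (n + 1)).frontier =
    (N.roundRequests 𝔗 ids Q.source
      (N.keptIndices tp (N.search 𝔗 ids tp Q (n + 1)).front.tmin)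
      (N.search 𝔗 ids tp Q n).frontier.queue).foldl N.serve
        ⟨(N.search 𝔗 ids tp Q n).frontier.reached, []⟩ := by
  simp only [roundRequests, List.foldl_flatMap, List.foldl_map]
  rfl

lemma search_inv (h𝔗 : N.IsTransferSet scheme 𝔗) (hids : N.ValidIDs ids 𝔗)
    (hQ : ∀ T i, Q.source = .fromEvent T i → 1 ≤ i) (n : ℕ) :
    N.FrontierInv ids 𝔗 Q (n + 1) (N.search 𝔗 ids tp Q n).frontier ∧
      N.FrontInv 𝔗 Q (N.search 𝔗 ids tp Q n).front := by
  induction n with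
  | zero =>
    obtain ⟨acc, -, -, h⟩ := exists_served_initial (N := N) (Q := Q) hids hQ
    exact ⟨h, by constructor <;> simp [search]⟩
  | succ n ih =>
    constructor
    · obtain ⟨acc, -, -, h⟩ := exists_served_round h𝔗 hids.2.2 (keptIndices_subset _)
        (pairwise_keptIndices _) (mem_keptIndices_of_lt (tp := tp)
          (N.search 𝔗 ids tp Q (n + 1)).front.tmin) ih.1
      rw [search_succ_frontier]
      exact h
    · rw [search_succ_front]
      exact ih.2.scanQueue ih.1.valid

/-- Each newly queued segment lowers the reached index of its trip, so the sum of these natural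
numbers cannot keep decreasing forever. -/
lemma terminates (h𝔗 : N.IsTransferSet scheme 𝔗) (hids : N.ValidIDs ids 𝔗)
    (hQ : ∀ T i, Q.source = .fromEvent T i → 1 ≤ i) : N.Terminates 𝔗 ids tp Q := by
  by_contra hne
  have hne : ∀ n, (N.search 𝔗 ids tp Q n).frontier.queue ≠ [] := fun n h => hne ⟨n, h⟩
  have hdec : ∀ n, ∑ T, (N.search 𝔗 ids tp Q (n + 1)).frontier.reached T <
      ∑ T, (N.search 𝔗 ids tp Q n).frontier.reached T := by
    intro n
    obtain ⟨acc, h, -⟩ := exists_served_round h𝔗 hids.2.2 (keptIndices_subset _)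
        (pairwise_keptIndices _) (mem_keptIndices_of_lt (tp := tp)
          (N.search 𝔗 ids tp Q (n + 1)).front.tmin) (search_inv (tp := tp) h𝔗 hids hQ n).1
    rw [← search_succ_frontier] at h
    have hacc : acc ≠ [] := by
      rintro rfl
      exact hne (n + 1) (by rw [h.queue_eq]; rfl)
    obtain ⟨x, hx⟩ := List.exists_mem_of_ne_nil acc hacc
    refine Finset.sum_lt_sum (fun T _ => h.reached_le T) ⟨x.1.trip, Finset.mem_univ _, ?_⟩
    have h1 := h.reached_le_board x.1 (h.sublist.subset (List.mem_map_of_mem hx))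
    have h2 := h.lt_reached x hx
    dsimp only at h2
    omega
  have hsum : ∀ n, ∑ T, (N.search 𝔗 ids tp Q n).frontier.reached T + n ≤
      ∑ T, (N.search 𝔗 ids tp Q 0).frontier.reached T := by
    intro n
    induction n with
    | zero => exact le_rfl
    | succ n ih => have := hdec n; omega
  have := hsum (∑ T, (N.search 𝔗 ids tp Q 0).frontier.reached T + 1)
  omega

/-- Before the final round, the search follows a minimal representative of a Pareto-optimal cost
vector. -/
lemma exists_mem_queue (h𝔗 : N.IsTransferSet scheme 𝔗) (hids : N.ValidIDs ids 𝔗)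
    (hQ : ∀ T i, Q.source = .fromEvent T i → 1 ≤ i) (hc : c ∈ N.paretoFront Q)
    (hex : N.Unexceptional scheme Q c) {J : List (Leg Trip)}
    (hmin : N.IsMinimalRep ids 𝔗 Q c J) (n : ℕ) (hn : n < J.length) :
    (c.1 : WithTop ℤ) < (N.search 𝔗 ids tp Q n).front.tmin ∧
      ∃ s ∈ (N.search 𝔗 ids tp Q n).frontier.queue, ∃ j ∈ s.indices, ∃ J',
        J = unpack 𝔗 s j ++ J' := by
  have hJc : J.length = c.2 := by
    rw [← hmin.2.1, cost_snd hmin.1.1.1.1]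
  have h0 : N.LeadsFrom Q.target c.1 Q.source J :=
    leadsFrom_iff.2 ⟨hmin.1.1, by rw [hmin.2.1]⟩
  induction n with
  | zero =>
    refine ⟨WithTop.coe_lt_top _, ?_⟩
    cases J with
    | nil => simp at hn
    | cons x J =>
      obtain ⟨i, hi, hq⟩ := exists_mem_initial_queue h𝔗 hids hQ hc hex hmin
      exact ⟨_, hq, x.exit, Segment.mem_indices.2 ⟨(LeadsFrom.rest (P := []) h0).1.2.1, hi⟩, J, rfl⟩
  | succ n ih =>
    obtain ⟨ht, s, hs, j, hj, J', rfl⟩ := ih (by omega)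
    have hinv := (search_inv (tp := tp) h𝔗 hids hQ n).1
    have hsv := hinv.valid s hs
    -- Segments in this queue stand for `n + 1` trips, which is fewer than `c.2`; arriving by `c.1`
    -- with them would beat a Pareto-optimal vector.
    have ht' : (c.1 : WithTop ℤ) < (N.search 𝔗 ids tp Q (n + 1)).front.tmin := by
      rw [search_succ_front]
      refine lt_tmin_scanQueue ht fun s' hs' i hi hf => ?_
      by_contra hle
      have hi := Segment.mem_indices.1 hi
      have hv := hinv.valid s' hs'
      have := pareto_length_le hc (Arrives.leadsFrom ⟨hv, hi.1, hi.2.trans hv.last_le, hf⟩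
        (not_lt.1 hle)) le_rfl
      rw [hv.length] at this
      omega
    refine ⟨ht', ?_⟩
    cases J' with
    | nil =>
      rw [List.append_nil, hsv.length] at hn
      omega
    | cons x J' =>
      have heq : unpack 𝔗 s j ++ x :: J' = s.before 𝔗 ++ ⟨s.trip, s.board, j⟩ :: x :: J' := by
        simp [unpack_eq]
      have hm : ((s.trip, j), (x.trip, x.board)) ∈ 𝔗 := by
        have := hmin.1.2
        rw [heq] at this
        exact (List.isChain_append_cons_cons.1 this).2.1
      have hx := h0.rest.1
      -- Times do not decrease along a journey, so the event where `s` is left is reached by `c.1`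
      -- and survives target pruning.
      have hjK : j ∈ N.keptIndices tp (N.search 𝔗 ids tp Q (n + 1)).front.tmin s := by
        refine mem_keptIndices hj hsv.last_le (lt_of_le_of_lt (WithTop.coe_le_coe.2 ?_) ht')
        rw [heq] at h0
        exact h0.rest.2.le
      obtain ⟨acc, h, hacc, -⟩ := exists_served_round h𝔗 hids.2.2 (keptIndices_subset _)
        (pairwise_keptIndices _) (mem_keptIndices_of_lt (tp := tp)
          (N.search 𝔗 ids tp Q (n + 1)).front.tmin) hinv
      rw [← search_succ_frontier] at h
      obtain ⟨i, hi, hi'⟩ := h.exists_mem_acc h𝔗 hc hex hmin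
        (fun _ _ _ _ h => by simp [unpack_eq] at h) (by rwa [hsv.length])
        (by rw [hsv.length]; exact hinv.reached_eq)
        (mem_roundRequests.2 ⟨s, hs, j, hjK, x.trip, x.board, hm, rfl⟩) rfl rfl
        (k := (x.exit : ℤ) :: tiebreakTail ids x J')
        (by rw [tiebreak_unpack]; simp [tiebreakTail]) (fun y hy => by
          have := h.sublist.subset (List.mem_map_of_mem hy)
          obtain ⟨s', hs', i', -, T, b, -, he⟩ := mem_roundRequests.1 this
          rw [he, List.length_append, List.length_append,
            (hinv.valid s' hs').segKey_length_eq ids hsv]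
          rfl)
      have hkey := (hacc _ hi').2.1
      -- The key of the queued segment contains the exit found by unpacking, and that of the request
      -- contains `j`.
      have he : s.exitTo 𝔗 (x.trip, x.board) = j := by
        simp only [segKey, List.append_cancel_left_eq, List.cons.injEq] at hkey
        exact_mod_cast hkey.1
      refine ⟨_, h.seg_mem_queue hi', x.exit, Segment.mem_indices.2 ⟨hx.2.1, hi⟩, J', ?_⟩
      have : unpack 𝔗 (.next s x.trip x.board i) x.exit =
        unpack 𝔗 s (s.exitTo 𝔗 (x.trip, x.board)) ++ [⟨x.trip, x.board, x.exit⟩] := rfl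
      rw [Request.seg, this, he, List.append_assoc]
      rfl

lemma search_front_mono (h𝔗 : N.IsTransferSet scheme 𝔗) (hids : N.ValidIDs ids 𝔗)
    (hQ : ∀ T i, Q.source = .fromEvent T i → 1 ≤ i) {e : Entry Trip}
    (hc : e.cost ∈ N.paretoFront Q) {n n' : ℕ} (hn : n ≤ n')
    (he : e ∈ (N.search 𝔗 ids tp Q n).front.entries) :
    e ∈ (N.search 𝔗 ids tp Q n').front.entries := by
  induction n', hn using Nat.le_induction with
  | base => exact he
  | succ n' _ ih =>
    rw [search_succ_front]
    exact mem_scanQueue_of_mem ih hc (search_inv h𝔗 hids hQ n').1.valid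

lemma search_queue_eq_nil {n n' : ℕ} (hn : n ≤ n')
    (h : (N.search 𝔗 ids tp Q n).frontier.queue = []) :
    (N.search 𝔗 ids tp Q n').frontier.queue = [] := by
  induction n', hn using Nat.le_induction with
  | base => exact h
  | succ n' _ ih =>
    rw [search_succ_frontier, ih]
    rfl

/-- The minimal representative of a Pareto-optimal cost vector is returned. -/
lemma returns_of_isMinimalRep (h𝔗 : N.IsTransferSet scheme 𝔗) (hids : N.ValidIDs ids 𝔗)
    (hQ : ∀ T i, Q.source = .fromEvent T i → 1 ≤ i) (hc : c ∈ N.paretoFront Q)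
    (hex : N.Unexceptional scheme Q c) {J : List (Leg Trip)}
    (hmin : N.IsMinimalRep ids 𝔗 Q c J) : N.Returns 𝔗 ids tp Q c J := by
  have hpos := List.length_pos_iff.2 hmin.1.1.1.1
  obtain ⟨ht, s, hs, j, hj, J', rfl⟩ :=
    exists_mem_queue (tp := tp) h𝔗 hids hQ hc hex hmin (J.length - 1) (by omega)
  set n := (unpack 𝔗 s j ++ J').length - 1 with hn
  have hinv := (search_inv (tp := tp) h𝔗 hids hQ n).1
  have hJ' : J' = [] := by
    rw [← List.length_eq_zero_iff]
    rw [List.length_append, (hinv.valid s hs).length] at hn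
    omega
  rw [hJ', List.append_nil] at hmin ⊢
  have hmem : ⟨c, s, j⟩ ∈ (N.search 𝔗 ids tp Q (n + 1)).front.entries := by
    rw [search_succ_front]
    exact mem_scanQueue hc hinv.sorted hinv.valid ht hs hj hmin
  refine ⟨⟨c, s, j⟩, search_front_mono h𝔗 hids hQ hc ?_ hmem, rfl, rfl⟩
  -- An empty queue stays empty, while the queue after `n` rounds contains `s`; hence the search
  -- does not stop before round `n + 1`.
  by_contra hlt
  have hnil := Nat.sInf_mem (s := {n | (N.search 𝔗 ids tp Q n).frontier.queue = []})
    (terminates h𝔗 hids hQ)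
  have := search_queue_eq_nil (by omega : _ ≤ n) hnil
  rw [this] at hs
  simp at hs

/-- At most one journey is returned for each cost vector. -/
lemma Returns.unique (h𝔗 : N.IsTransferSet scheme 𝔗) (hids : N.ValidIDs ids 𝔗)
    (hQ : ∀ T i, Q.source = .fromEvent T i → 1 ≤ i) {J J' : List (Leg Trip)}
    (h : N.Returns 𝔗 ids tp Q c J) (h' : N.Returns 𝔗 ids tp Q c J') : J = J' := by
  obtain ⟨e, he, hec, rfl⟩ := h
  obtain ⟨e', he', hec', rfl⟩ := h'
  by_contra hne
  have hee : e ≠ e' := fun h => hne (h ▸ rfl)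
  have hinv := (search_inv (tp := tp) h𝔗 hids hQ
    (sInf {n | (N.search 𝔗 ids tp Q n).frontier.queue = []})).2
  -- Strictly decreasing arrival times make the cost vectors of different entries different.
  have hp := hinv.sorted.imp (S := fun e e' => e.cost ≠ e'.cost) fun h he => by
    rw [he] at h
    exact lt_irrefl _ h
  have : Std.Symm (fun e e' : Entry Trip => e.cost ≠ e'.cost) := ⟨fun _ _ => Ne.symm⟩
  exact hp.forall he he' hee (hec.trans hec'.symm)

lemma Returns.mem_journeysIn (h𝔗 : N.IsTransferSet scheme 𝔗) (hids : N.ValidIDs ids 𝔗)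
    (hQ : ∀ T i, Q.source = .fromEvent T i → 1 ≤ i) {J : List (Leg Trip)}
    (h : N.Returns 𝔗 ids tp Q c J) : J ∈ N.journeysIn Q 𝔗 ∧ N.cost Q.target J = c := by
  obtain ⟨e, he, rfl, rfl⟩ := h
  have hinv := (search_inv (tp := tp) h𝔗 hids hQ
    (sInf {n | (N.search 𝔗 ids tp Q n).frontier.queue = []})).2
  obtain ⟨h1, h2⟩ := hinv.arrives e he
  exact ⟨h1.mem_journeysIn, by rw [h1.cost_eq, ← h2]⟩

end Search

end Network

end

end TB

theorem mainTheorem3 {Stop Line Trip : Type*} [DecidableEq Stop] [DecidableEq Line] [Fintype Line]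
    [DecidableEq Trip] [Fintype Trip] (N : TB.Network Stop Line Trip) (scheme : TB.Scheme)
    (𝔗 : Finset (TB.Transfer Trip)) (h𝔗 : N.IsTransferSet scheme 𝔗)
    (ids : TB.IDs Stop Line Trip) (hids : N.ValidIDs ids 𝔗)
    (Q : TB.Query Stop Trip)
    (hQ : ∀ T i, Q.source = .fromEvent T i → 1 ≤ i ∧ i ≤ N.len (N.line T))
    (targetPruning : Bool) :
    -- the search terminates, and it returns feasible journeys with the stated cost vectors
    N.Terminates 𝔗 ids targetPruning Q ∧
    (∀ c J, N.Returns 𝔗 ids targetPruning Q c J →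
      J ∈ N.journeysIn Q 𝔗 ∧ N.cost Q.target J = c) ∧
    -- for Pareto-optimal cost vectors, exactly the minimal representative is returned
    ∀ c ∈ N.paretoFront Q,
      -- only for Witt's scheme: journeys that are no better than walking, and event-based queries
      -- whose cost vector is not attained with the transfers in `𝔗`, are left out
      (scheme = .witt → ∀ p τ, Q.source = .fromStop p τ → (p, Q.target) ∈ N.footpaths →
        c.1 < τ + N.walk p Q.target) →
      (scheme = .witt → ∀ T i, Q.source = .fromEvent T i →
        ∃ J ∈ N.journeysIn Q 𝔗, N.cost Q.target J = c) →
      ∃ J, N.IsMinimalRep ids 𝔗 Q c J ∧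
        ∀ J', N.Returns 𝔗 ids targetPruning Q c J' ↔ J' = J := by
  have hQ' : ∀ T i, Q.source = .fromEvent T i → 1 ≤ i := fun T i h => (hQ T i h).1
  refine ⟨TB.Network.terminates h𝔗 hids hQ', fun c J h => h.mem_journeysIn h𝔗 hids hQ',
    fun c hc hex hev => ?_⟩
  obtain ⟨J, hJ⟩ := TB.Network.exists_isMinimalRep hids
    (TB.Network.exists_journeysIn h𝔗 hc hex hev)
  have hret := TB.Network.returns_of_isMinimalRep (tp := targetPruning) h𝔗 hids hQ' hc hex hJ
  refine ⟨J, hJ, fun J' => ⟨fun h => h.unique h𝔗 hids hQ' hret, ?_⟩⟩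
  rintro rfl
  exact hret
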